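/- Let $k$ be a commutative ring and $A$ a commutative $k$-algebra. A Hasse--Schmidt derivation of $A$ over $k$ of length $m\in\mathbb N\cup\{\infty\}$ is a family $D=(D_n)_{0\le n\le m}$ (over all integers $n\ge 0$ if $m=\infty$) of $k$-linear maps $D_n:A\to A$ with $D_0=\mathrm{Id}_A$ and $D_n(xy)=\sum_{i+j=n}D_i(x)D_j(y)$. For $m\geq 1$, a $k$-derivation $\delta$ of $A$ is $m$-integrable if $\delta=D_1$ for some such $D$ of length $m$ (an $m$-integral of $\delta$). Let $\mathrm{IDer}_k(A;\infty)$ be the $A$-module of $\infty$-integrable $k$-derivations, and $\mathrm{IDer}^f_k(A)$ the $A$-module of $k$-derivations that are $m$-integrable for every integer $m\ge 1$. Let $\mathcal D_{A/k}=\bigcup_{n\geq 0}\mathcal D^n_{A/k}$ be the ring of $k$-linear differential operators of $A$, filtered by the order ($\mathcal D^{-1}_{A/k}=0$, and $P\in\mathcal D^n_{A/k}$ iff $[P,a]\in\mathcal D^{n-1}_{A/k}$ for all $a\in A$), let $\sigma_n:\mathcal D^n_{A/k}\to \mathcal D^n_{A/k}/\mathcal D^{n-1}_{A/k}$ be the symbol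 maps, and give the commutative graded ring $\mathrm{gr}\,\mathcal D_{A/k}$ its Poisson bracket over $k$, $\{\sigma_d(P),\sigma_e(Q)\}=\sigma_{d+e-1}([P,Q])$ (which is $0$ for $d=e=0$). Let $L$ be $\mathrm{IDer}^f_k(A)$ or $\mathrm{IDer}_k(A;\infty)$, and let $\Gamma_A L$ be its divided power algebra, graded with $\gamma_n(\delta)$ in degree $n$. Then: 1. $L$ is closed under the bracket $[\delta,\varepsilon]=\delta\varepsilon-\varepsilon\delta$, so that it is a Lie--Rinehart algebra over $A/k$ with the inclusion into $\mathrm{Der}_k(A)$ as anchor, and there is a unique Poisson structure over $k$ on $\Gamma_A L$ such that $\{a,b\}=0$, $\{\gamma_m(\delta),a\}=\delta(a)\gamma_{m-1}(\delta)$ and $\{\gamma_m(\delta),\gamma_n(\varepsilon)\}=\gamma_{m-1}(\delta)\gamma_{n-1}(\varepsilon)\gamma_1([\delta,\varepsilon])$ for all $a,b\in A$, $\delta,\varepsilon\in L$, $m,n\ge 1$. 2. There is a unique map of graded $A$-algebras $\vartheta:\Gamma_A L\to\mathrm{gr}\,\mathcal D_{A/k}$ (denoted $\vartheta^f$ for $L=\mathrm{IDer}^f_k(A)$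 and $\vartheta^\infty$ for $L=\mathrm{IDer}_k(A;\infty)$) such that $\vartheta(\gamma_n(\delta))=\sigma_n(D_n)$ for all $\delta\in L$, all $n\ge1$ and every $n$-integral $D$ of $\delta$ (for $L=\mathrm{IDer}^f_k(A)$), respectively every $\infty$-integral $D$ of $\delta$ (for $L=\mathrm{IDer}_k(A;\infty)$). 3. $\vartheta$ is a map of Poisson algebras: $\vartheta(\{x,y\})=\{\vartheta(x),\vartheta(y)\}$ for all $x,y\in\Gamma_A L$. -/

import Mathlib

open scoped DirectSum

noncomputable section

namespace PoissonHS

/-! ### Poisson algebras -/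

/-- A Poisson structure on a commutative `k`-algebra `B`: a `k`-bilinear bracket which is
skew-symmetric (in the alternating sense), satisfies the Jacobi identity, and is a derivation
in its second (hence in each) variable. -/
@[ext]
structure PoissonStructure (k B : Type*) [CommRing k] [CommRing B] [Algebra k B] where
  bracket : B →ₗ[k] B →ₗ[k] B
  bracket_self : ∀ x, bracket x x = 0
  bracket_mul : ∀ x y z, bracket x (y * z) = bracket x y * z + y * bracket x z
  jacobi : ∀ x y z,
    bracket x (bracket y z) + bracket y (bracket z x) + bracket z (bracket x y) = 0

/-- A map compatible with the Poisson brackets. -/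
def IsPoissonMap {k B C : Type*} [CommRing k] [CommRing B] [Algebra k B] [CommRing C]
    [Algebra k C] (P : PoissonStructure k B) (Q : PoissonStructure k C) (f : B → C) : Prop :=
  ∀ x y, f (P.bracket x y) = Q.bracket (f x) (f y)

/-! ### Subquotients of a module -/

/-- The quotient of a submodule `S` by (its intersection with) a submodule `T`. -/
def SubQuot {R M : Type*} [Ring R] [AddCommGroup M] [Module R M] (S T : Submodule R M) : Type _ :=
  S ⧸ T.submoduleOf S

namespace SubQuot

variable {k R M : Type*} [Ring R] [AddCommGroup M] [Module R M] {S T : Submodule R M}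

instance : AddCommGroup (SubQuot S T) :=
  inferInstanceAs (AddCommGroup (S ⧸ T.submoduleOf S))

instance [Semiring k] [SMul k R] [Module k M] [IsScalarTower k R M] : Module k (SubQuot S T) :=
  inferInstanceAs (Module k (S ⧸ T.submoduleOf S))

/-- The quotient map. -/
def mk : S →ₗ[R] SubQuot S T := (T.submoduleOf S).mkQ

theorem mk_surjective : Function.Surjective (mk (S := S) (T := T)) := Submodule.mkQ_surjective _

theorem mk_eq_iff {x y : S} : mk (T := T) x = mk y ↔ (x : M) - y ∈ T :=
  Submodule.Quotient.eq (T.submoduleOf S)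

theorem mk_ksmul [Semiring k] [SMul k R] [Module k M] [IsScalarTower k R M] (c : k) (x : S) :
    mk (T := T) (c • x) = c • mk x := rfl

/-- Functions of two variables on subquotients. -/
def lift₂ {M' N : Type*} [AddCommGroup M'] [Module R M'] {S' T' : Submodule R M'}
    (f : S → S' → N)
    (h : ∀ (x : S) (y : S') (x' : S) (y' : S'), (x : M) - x' ∈ T → (y : M') - y' ∈ T' → f x y = f x' y') :
    SubQuot S T → SubQuot S' T' → N :=
  Quotient.lift₂ f fun x y x' y' hx hy =>
    h x y x' y' (mk_eq_iff.1 (Quotient.sound hx)) (mk_eq_iff.1 (Quotient.sound hy))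

theorem lift₂_mk {M' N : Type*} [AddCommGroup M'] [Module R M'] {S' T' : Submodule R M'}
    (f : S → S' → N)
    (h : ∀ (x : S) (y : S') (x' : S) (y' : S'), (x : M) - x' ∈ T → (y : M') - y' ∈ T' → f x y = f x' y') (x : S) (y : S') :
    lift₂ f h (mk x) (mk y) = f x y := rfl

end SubQuot

/-! ### Linear differential operators -/

theorem mul_commutator {R : Type*} [Ring R] (P Q m : R) :
    P * Q * m - m * (P * Q) = P * (Q * m - m * Q) + (P * m - m * P) * Q := by
  noncomm_ring

theorem commutator_commutator {R : Type*} [Ring R] (P Q m : R) :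
    (P * Q - Q * P) * m - m * (P * Q - Q * P)
      = (P * (Q * m - m * Q) - (Q * m - m * Q) * P)
        + ((P * m - m * P) * Q - Q * (P * m - m * P)) := by
  noncomm_ring

theorem mul_sub_mul {R : Type*} [Ring R] (P P' Q Q' : R) :
    P * Q - P' * Q' = (P - P') * Q + P' * (Q - Q') := by
  noncomm_ring

theorem commutator_sub_commutator {R : Type*} [Ring R] (P P' Q Q' : R) :
    P * Q - Q * P - (P' * Q' - Q' * P')
      = ((P - P') * Q - Q * (P - P')) + (P' * (Q - Q') - (Q - Q') * P') := by
  noncomm_ring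

section DiffOp

variable (k A : Type*) [CommRing k] [CommRing A] [Algebra k A]

/-- `diffOpLT k A n` is the left `A`-module of the `k`-linear differential operators of `A` of
order `< n`: the zero operator for `n = 0`, and `P` has order `< n + 1` if all the commutators
`[P, a]` with the multiplication operators, `a ∈ A`, have order `< n`. -/
def diffOpLT : ℕ → Submodule A (Module.End k A)
  | 0 => ⊥
  | n + 1 =>
    { carrier := {P | ∀ a : A, P * LinearMap.mulLeft k a - LinearMap.mulLeft k a * P
        ∈ diffOpLT n}
      zero_mem' := fun a => by simp
      add_mem' := fun {P Q} hP hQ a => by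
        have h := add_mem (hP a) (hQ a)
        rwa [sub_add_sub_comm, ← add_mul, ← mul_add] at h
      smul_mem' := fun b P hP a => by
        have h := (diffOpLT n).smul_mem b (hP a)
        have e : (b • P) * LinearMap.mulLeft k a - LinearMap.mulLeft k a * (b • P)
            = b • (P * LinearMap.mulLeft k a - LinearMap.mulLeft k a * P) := by
          ext x
          simp [mul_sub, mul_left_comm]
        change (b • P) * LinearMap.mulLeft k a - LinearMap.mulLeft k a * (b • P) ∈ diffOpLT n
        rw [e]
        exact h }

/-- The differential operators of order `≤ n`. -/
abbrev diffOp (n : ℕ) : Submodule A (Module.End k A) := diffOpLT k A (n + 1)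

variable {k A}

theorem mem_diffOpLT_succ {n : ℕ} {P : Module.End k A} :
    P ∈ diffOpLT k A (n + 1) ↔ ∀ a : A,
      P * LinearMap.mulLeft k a - LinearMap.mulLeft k a * P ∈ diffOpLT k A n := Iff.rfl

theorem diffOpLT_le_succ (n : ℕ) : diffOpLT k A n ≤ diffOpLT k A (n + 1) := by
  induction n with
  | zero => exact bot_le
  | succ n ih => exact fun P hP a => ih (hP a)

theorem diffOpLT_mono {m n : ℕ} (h : m ≤ n) : diffOpLT k A m ≤ diffOpLT k A n :=
  monotone_nat_of_le_succ diffOpLT_le_succ h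

theorem eq_zero_of_mem_zero {P : Module.End k A} (h : P ∈ diffOpLT k A 0) : P = 0 := by
  simpa [diffOpLT] using h

theorem mul_mem_diffOp (N : ℕ) : ∀ {i j : ℕ} {P Q : Module.End k A}, i + j = N →
    P ∈ diffOpLT k A (i + 1) → Q ∈ diffOpLT k A (j + 1) → P * Q ∈ diffOpLT k A (N + 1) := by
  induction N with
  | zero =>
    intro i j P Q h hP hQ a
    obtain ⟨rfl, rfl⟩ : i = 0 ∧ j = 0 := by omega
    have h1 := eq_zero_of_mem_zero (hP a)
    have h2 := eq_zero_of_mem_zero (hQ a)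
    rw [sub_eq_zero] at h1 h2
    rw [mul_assoc, h2, ← mul_assoc, h1, mul_assoc, sub_self]
    exact zero_mem _
  | succ N ih =>
    intro i j P Q h hP hQ a
    rw [mul_commutator]
    refine add_mem ?_ ?_
    · cases j with
      | zero => rw [eq_zero_of_mem_zero (hQ a), mul_zero]; exact zero_mem _
      | succ j => exact ih (by omega) hP (hQ a)
    · cases i with
      | zero => rw [eq_zero_of_mem_zero (hP a), zero_mul]; exact zero_mem _
      | succ i => exact ih (by omega) (hP a) hQ

theorem mul_mem_left {i j : ℕ} {P Q : Module.End k A}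
    (hP : P ∈ diffOpLT k A i) (hQ : Q ∈ diffOpLT k A (j + 1)) : P * Q ∈ diffOpLT k A (i + j) := by
  cases i with
  | zero => rw [eq_zero_of_mem_zero hP, zero_mul]; exact zero_mem _
  | succ i =>
    have := mul_mem_diffOp _ rfl hP hQ
    rwa [show i + 1 + j = i + j + 1 by omega]

theorem mul_mem_right {i j : ℕ} {P Q : Module.End k A}
    (hP : P ∈ diffOpLT k A (i + 1)) (hQ : Q ∈ diffOpLT k A j) : P * Q ∈ diffOpLT k A (i + j) := by
  cases j with
  | zero => rw [eq_zero_of_mem_zero hQ, mul_zero]; exact zero_mem _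
  | succ j => exact mul_mem_diffOp _ rfl hP hQ

theorem apply_of_mem_one {P : Module.End k A} (hP : P ∈ diffOpLT k A 1) (x : A) :
    P x = x * P 1 := by
  have h := LinearMap.congr_fun (eq_zero_of_mem_zero (hP x)) 1
  simpa [sub_eq_zero] using h

theorem commutator_mem (N : ℕ) : ∀ {i j : ℕ} {P Q : Module.End k A}, i + j = N →
    P ∈ diffOpLT k A (i + 1) → Q ∈ diffOpLT k A (j + 1) → P * Q - Q * P ∈ diffOpLT k A N := by
  induction N with
  | zero =>
    intro i j P Q h hP hQ
    obtain ⟨rfl, rfl⟩ : i = 0 ∧ j = 0 := by omega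
    have e : P * Q - Q * P = 0 := by
      ext x
      rw [LinearMap.sub_apply, Module.End.mul_apply, Module.End.mul_apply,
        apply_of_mem_one hP (Q x), apply_of_mem_one hQ (P x), apply_of_mem_one hP x,
        apply_of_mem_one hQ x, LinearMap.zero_apply]
      ring
    rw [e]
    exact zero_mem _
  | succ N ih =>
    intro i j P Q h hP hQ a
    rw [commutator_commutator]
    refine add_mem ?_ ?_
    · cases j with
      | zero => rw [eq_zero_of_mem_zero (hQ a), mul_zero, zero_mul, sub_zero]; exact zero_mem _
      | succ j => exact ih (by omega) hP (hQ a)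
    · cases i with
      | zero => rw [eq_zero_of_mem_zero (hP a), mul_zero, zero_mul, sub_zero]; exact zero_mem _
      | succ i => exact ih (by omega) (hP a) hQ

theorem commutator_mem_diffOp {i j : ℕ} {P Q : Module.End k A}
    (hP : P ∈ diffOp k A i) (hQ : Q ∈ diffOp k A j) : P * Q - Q * P ∈ diffOp k A (i + j - 1) :=
  diffOpLT_mono (by omega) (commutator_mem _ rfl hP hQ)

theorem commutator_mem_left {i j : ℕ} {P Q : Module.End k A}
    (hP : P ∈ diffOpLT k A i) (hQ : Q ∈ diffOp k A j) :
    P * Q - Q * P ∈ diffOpLT k A (i + j - 1) := by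
  cases i with
  | zero => rw [eq_zero_of_mem_zero hP, mul_zero, zero_mul, sub_zero]; exact zero_mem _
  | succ i => exact diffOpLT_mono (by omega) (commutator_mem _ rfl hP hQ)

theorem commutator_mem_right {i j : ℕ} {P Q : Module.End k A}
    (hP : P ∈ diffOp k A i) (hQ : Q ∈ diffOpLT k A j) :
    P * Q - Q * P ∈ diffOpLT k A (i + j - 1) := by
  have h := neg_mem (commutator_mem_left hQ hP)
  rwa [neg_sub, add_comm] at h

theorem one_mem_diffOp : (1 : Module.End k A) ∈ diffOp k A 0 := fun a => by simp

/-! ### The associated graded ring -/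

variable (k A) in
/-- The graded piece of degree `n`: operators of order `≤ n` modulo operators of order `< n`. -/
abbrev Gr (n : ℕ) : Type _ := SubQuot (diffOp k A n) (diffOpLT k A n)

/-- The symbol map. -/
def symb (n : ℕ) : diffOp k A n →ₗ[A] Gr k A n := SubQuot.mk

theorem symb_surjective (n : ℕ) : Function.Surjective (symb (k := k) (A := A) n) :=
  SubQuot.mk_surjective

theorem symb_eq_iff {n : ℕ} {P Q : diffOp k A n} :
    symb n P = symb n Q ↔ (P : Module.End k A) - Q ∈ diffOpLT k A n :=
  SubQuot.mk_eq_iff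

theorem symb_ksmul {n : ℕ} (c : k) (P : diffOp k A n) : symb n (c • P) = c • symb n P := rfl

/-- The product of differential operators, with values in the appropriate step. -/
def opMul {i j : ℕ} (P : diffOp k A i) (Q : diffOp k A j) : diffOp k A (i + j) :=
  ⟨P.1 * Q.1, mul_mem_diffOp _ rfl P.2 Q.2⟩

/-- The commutator of differential operators, with values in the appropriate step
(for `i = j = 0` the commutator is zero). -/
def opComm {i j : ℕ} (P : diffOp k A i) (Q : diffOp k A j) : diffOp k A (i + j - 1) :=
  ⟨P.1 * Q.1 - Q.1 * P.1, commutator_mem_diffOp P.2 Q.2⟩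

theorem coe_opMul {i j : ℕ} (P : diffOp k A i) (Q : diffOp k A j) :
    (opMul P Q : Module.End k A) = (P : Module.End k A) * (Q : Module.End k A) := rfl

theorem coe_opComm {i j : ℕ} (P : diffOp k A i) (Q : diffOp k A j) :
    (opComm P Q : Module.End k A) = (P : Module.End k A) * (Q : Module.End k A)
      - (Q : Module.End k A) * (P : Module.End k A) := rfl

/-- `σ_i(P) σ_j(Q) = σ_{i+j}(P Q)`. -/
def grMul {i j : ℕ} : Gr k A i → Gr k A j → Gr k A (i + j) :=
  SubQuot.lift₂ (fun P Q => symb (i + j) (opMul P Q)) fun P Q P' Q' hP hQ => by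
    rw [symb_eq_iff, coe_opMul, coe_opMul, mul_sub_mul]
    exact add_mem (mul_mem_left hP Q.2) (mul_mem_right P'.2 hQ)

/-- `{σ_i(P), σ_j(Q)} = σ_{i+j-1}([P, Q])`. -/
def grComm {i j : ℕ} : Gr k A i → Gr k A j → Gr k A (i + j - 1) :=
  SubQuot.lift₂ (fun P Q => symb (i + j - 1) (opComm P Q)) fun P Q P' Q' hP hQ => by
    rw [symb_eq_iff, coe_opComm, coe_opComm, commutator_sub_commutator]
    exact add_mem (commutator_mem_left hP Q.2) (commutator_mem_right P'.2 hQ)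

theorem grMul_symb {i j : ℕ} (P : diffOp k A i) (Q : diffOp k A j) :
    grMul (symb i P) (symb j Q) = symb (i + j) (opMul P Q) := rfl

theorem grComm_symb {i j : ℕ} (P : diffOp k A i) (Q : diffOp k A j) :
    grComm (symb i P) (symb j Q) = symb (i + j - 1) (opComm P Q) := rfl

theorem mk_symb_eq {m n : ℕ} (h : m = n) {P : diffOp k A m} {Q : diffOp k A n}
    (e : (P : Module.End k A) - Q ∈ diffOpLT k A n) :
    GradedMonoid.mk (A := Gr k A) m (symb m P) = GradedMonoid.mk n (symb n Q) := by
  subst h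
  rw [symb_eq_iff.2 e]

theorem mk_symb_eq' {m n : ℕ} (h : m = n) {P : diffOp k A m} {Q : diffOp k A n}
    (e : (P : Module.End k A) = Q) :
    GradedMonoid.mk (A := Gr k A) m (symb m P) = GradedMonoid.mk n (symb n Q) :=
  mk_symb_eq h (by rw [e, sub_self]; exact zero_mem _)

theorem mulLeft_mem_diffOp (a : A) : LinearMap.mulLeft k a ∈ diffOp k A 0 := fun b => by
  have e : LinearMap.mulLeft k a * LinearMap.mulLeft k b
      - LinearMap.mulLeft k b * LinearMap.mulLeft k a = 0 := by
    ext x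
    simp [mul_left_comm]
  rw [e]
  exact zero_mem _

instance instGMul : GradedMonoid.GMul (Gr k A) := ⟨grMul⟩

instance instGOne : GradedMonoid.GOne (Gr k A) := ⟨symb 0 ⟨1, one_mem_diffOp⟩⟩

theorem mk_symb_mul {i j : ℕ} (P : diffOp k A i) (Q : diffOp k A j) :
    GradedMonoid.mk (A := Gr k A) i (symb i P) * GradedMonoid.mk j (symb j Q)
      = GradedMonoid.mk (i + j) (symb (i + j) (opMul P Q)) := rfl

theorem mk_symb_mul_comm {i j : ℕ} (P : diffOp k A i) (Q : diffOp k A j) :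
    GradedMonoid.mk (A := Gr k A) i (symb i P) * GradedMonoid.mk j (symb j Q)
      = GradedMonoid.mk j (symb j Q) * GradedMonoid.mk i (symb i P) := by
  rw [mk_symb_mul, mk_symb_mul]
  exact mk_symb_eq (add_comm i j) (commutator_mem _ (add_comm i j) P.2 Q.2)

instance instGCommRing : DirectSum.GCommRing (Gr k A) where
  mul_zero {i j} a := by
    obtain ⟨P, rfl⟩ := symb_surjective _ a
    rw [← map_zero (symb j), ← map_zero (symb (i + j))]
    exact congrArg (symb (i + j)) (Subtype.ext (mul_zero P.1))
  zero_mul {i j} a := by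
    obtain ⟨P, rfl⟩ := symb_surjective _ a
    rw [← map_zero (symb i), ← map_zero (symb (i + j))]
    exact congrArg (symb (i + j)) (Subtype.ext (zero_mul P.1))
  mul_add {i j} a b c := by
    obtain ⟨P, rfl⟩ := symb_surjective _ a
    obtain ⟨Q, rfl⟩ := symb_surjective _ b
    obtain ⟨R, rfl⟩ := symb_surjective _ c
    rw [← map_add]
    exact (congrArg (symb (i + j)) (Subtype.ext (mul_add P.1 Q.1 R.1))).trans (map_add _ _ _)
  add_mul {i j} a b c := by
    obtain ⟨P, rfl⟩ := symb_surjective _ a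
    obtain ⟨Q, rfl⟩ := symb_surjective _ b
    obtain ⟨R, rfl⟩ := symb_surjective _ c
    rw [← map_add]
    exact (congrArg (symb (i + j)) (Subtype.ext (add_mul P.1 Q.1 R.1))).trans (map_add _ _ _)
  one_mul := by
    rintro ⟨i, a⟩
    obtain ⟨P, rfl⟩ := symb_surjective _ a
    exact mk_symb_eq' (P := opMul ⟨1, one_mem_diffOp⟩ P) (zero_add i) (one_mul P.1)
  mul_one := by
    rintro ⟨i, a⟩
    obtain ⟨P, rfl⟩ := symb_surjective _ a
    exact mk_symb_eq' (P := opMul P ⟨1, one_mem_diffOp⟩) (add_zero i) (mul_one P.1)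
  mul_assoc := by
    rintro ⟨i, a⟩ ⟨j, b⟩ ⟨l, c⟩
    obtain ⟨P, rfl⟩ := symb_surjective _ a
    obtain ⟨Q, rfl⟩ := symb_surjective _ b
    obtain ⟨R, rfl⟩ := symb_surjective _ c
    exact mk_symb_eq' (P := opMul (opMul P Q) R) (Q := opMul P (opMul Q R)) (add_assoc i j l)
      (mul_assoc P.1 Q.1 R.1)
  mul_comm := by
    rintro ⟨i, a⟩ ⟨j, b⟩
    obtain ⟨P, rfl⟩ := symb_surjective _ a
    obtain ⟨Q, rfl⟩ := symb_surjective _ b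
    exact mk_symb_mul_comm P Q
  natCast n := n • symb 0 ⟨1, one_mem_diffOp⟩
  natCast_zero := zero_nsmul _
  natCast_succ n := succ_nsmul _ _
  intCast n := n • symb 0 ⟨1, one_mem_diffOp⟩
  intCast_ofNat n := natCast_zsmul _ _
  intCast_negSucc_ofNat n := negSucc_zsmul _ _

/-- The symbols of the multiplication operators. -/
def symbMulLeft : A →+ Gr k A 0 where
  toFun a := symb 0 ⟨LinearMap.mulLeft k a, mulLeft_mem_diffOp a⟩
  map_zero' := by
    rw [← map_zero (symb 0)]
    exact congrArg (symb 0) (Subtype.ext (by ext x; simp))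
  map_add' a b := by
    rw [← map_add]
    exact congrArg (symb 0) (Subtype.ext (by ext x; simp [add_mul]))

theorem symbMulLeft_apply (a : A) : symbMulLeft a
    = symb (k := k) 0 ⟨LinearMap.mulLeft k a, mulLeft_mem_diffOp a⟩ := rfl

theorem symbMulLeft_one : symbMulLeft (1 : A) = (GradedMonoid.GOne.one : Gr k A 0) :=
  congrArg (symb 0) (Subtype.ext (by ext x; simp))

theorem symbMulLeft_mul (a b : A) :
    GradedMonoid.mk (A := Gr k A) 0 (symbMulLeft (a * b))
      = GradedMonoid.mk 0 (symbMulLeft a) * GradedMonoid.mk 0 (symbMulLeft b) := by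
  rw [symbMulLeft_apply, symbMulLeft_apply, symbMulLeft_apply, mk_symb_mul]
  refine mk_symb_eq' rfl ?_
  ext x
  simp [opMul]

theorem symbMulLeft_comm (a : A) (x : GradedMonoid (Gr k A)) :
    GradedMonoid.mk 0 (symbMulLeft a) * x = x * GradedMonoid.mk 0 (symbMulLeft a) := by
  obtain ⟨i, x⟩ := x
  obtain ⟨P, rfl⟩ := symb_surjective _ x
  rw [symbMulLeft_apply]
  exact mk_symb_mul_comm _ _

theorem smul_mk_symb (a : A) {i : ℕ} (P : diffOp k A i) :
    GradedMonoid.mk (A := Gr k A) i (symb i (a • P))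
      = GradedMonoid.mk 0 (symbMulLeft a) * GradedMonoid.mk i (symb i P) := by
  rw [symbMulLeft_apply, mk_symb_mul]
  refine mk_symb_eq' (zero_add i).symm ?_
  ext x
  simp [opMul]

instance instGAlgebra : DirectSum.GAlgebra A (Gr k A) where
  toFun := symbMulLeft
  map_one := symbMulLeft_one
  map_mul r s := symbMulLeft_mul r s
  commutes r x := symbMulLeft_comm r x
  smul_def r := by
    rintro ⟨i, x⟩
    obtain ⟨P, rfl⟩ := symb_surjective _ x
    exact smul_mk_symb r P

instance instGAlgebraBase : DirectSum.GAlgebra k (Gr k A) where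
  toFun := symbMulLeft.comp (algebraMap k A).toAddMonoidHom
  map_one := by
    simpa using symbMulLeft_one (k := k) (A := A)
  map_mul r s := by
    change GradedMonoid.mk 0 (symbMulLeft (algebraMap k A (r * s))) = _
    rw [map_mul]
    exact symbMulLeft_mul _ _
  commutes r x := symbMulLeft_comm (algebraMap k A r) x
  smul_def r := by
    rintro ⟨i, x⟩
    obtain ⟨P, rfl⟩ := symb_surjective _ x
    refine Eq.trans ?_ (smul_mk_symb (algebraMap k A r) P)
    have e : (algebraMap k A r) • P = r • P := by
      apply Subtype.ext
      ext x
      simp [Algebra.smul_def]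
    rw [e]
    rfl

variable (k A) in
/-- The graded ring `gr D_{A/k}` of the ring of differential operators of `A` over `k`. -/
abbrev GrDiffOp : Type _ := ⨁ n, Gr k A n

/-- The class in `gr D_{A/k}` of the `n`-symbol of an operator of order `≤ n`. -/
def symbol (n : ℕ) (P : diffOp k A n) : GrDiffOp k A := DirectSum.of (Gr k A) n (symb n P)

theorem symbol_mul {i j : ℕ} (P : diffOp k A i) (Q : diffOp k A j) :
    symbol i P * symbol j Q = symbol (i + j) (opMul P Q) :=
  DirectSum.of_mul_of _ _

theorem symbol_add {n : ℕ} (P Q : diffOp k A n) : symbol n (P + Q) = symbol n P + symbol n Q := by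
  rw [symbol, map_add, map_add, symbol, symbol]

theorem symbol_zero {n : ℕ} : symbol n (0 : diffOp k A n) = 0 := by
  rw [symbol, map_zero, map_zero]

theorem symbol_shift {m n : ℕ} (P : diffOp k A m) (h : m = n ∨ (P : Module.End k A) = 0) :
    ∃ h' : (P : Module.End k A) ∈ diffOp k A n, symbol m P = symbol n ⟨P, h'⟩ := by
  rcases h with rfl | h
  · exact ⟨P.2, rfl⟩
  · refine ⟨by rw [h]; exact zero_mem _, ?_⟩
    have e : P = 0 := Subtype.ext h
    subst e
    rw [symbol_zero]
    exact symbol_zero.symm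

theorem grDiffOp_induction {C : GrDiffOp k A → Prop} (x : GrDiffOp k A)
    (h : ∀ n (P : diffOp k A n), C (symbol n P)) (hadd : ∀ x y, C x → C y → C (x + y)) : C x := by
  induction x using DirectSum.induction_on with
  | zero => rw [← symbol_zero (n := 0)]; exact h 0 0
  | of i x =>
    obtain ⟨P, rfl⟩ := symb_surjective _ x
    exact h i P
  | add x y hx hy => exact hadd x y hx hy

/-- The bracket on homogeneous components as a bilinear map. -/
def grCommHom (i j : ℕ) : Gr k A i →ₗ[k] Gr k A j →ₗ[k] Gr k A (i + j - 1) :=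
  LinearMap.mk₂ k grComm
    (fun a b c => by
      obtain ⟨P, rfl⟩ := symb_surjective _ a
      obtain ⟨Q, rfl⟩ := symb_surjective _ b
      obtain ⟨R, rfl⟩ := symb_surjective _ c
      rw [← map_add, grComm_symb, grComm_symb, grComm_symb, ← map_add]
      refine congrArg (symb _) (Subtype.ext ?_)
      simp only [opComm, Submodule.coe_add, add_mul, mul_add]
      abel)
    (fun c a b => by
      obtain ⟨P, rfl⟩ := symb_surjective _ a
      obtain ⟨Q, rfl⟩ := symb_surjective _ b
      rw [← symb_ksmul, grComm_symb, grComm_symb, ← symb_ksmul]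
      refine congrArg (symb _) (Subtype.ext ?_)
      ext x
      simp [opComm, smul_sub])
    (fun a b c => by
      obtain ⟨P, rfl⟩ := symb_surjective _ a
      obtain ⟨Q, rfl⟩ := symb_surjective _ b
      obtain ⟨R, rfl⟩ := symb_surjective _ c
      rw [← map_add, grComm_symb, grComm_symb, grComm_symb, ← map_add]
      refine congrArg (symb _) (Subtype.ext ?_)
      simp only [opComm, Submodule.coe_add, add_mul, mul_add]
      abel)
    (fun c a b => by
      obtain ⟨P, rfl⟩ := symb_surjective _ a
      obtain ⟨Q, rfl⟩ := symb_surjective _ b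
      rw [← symb_ksmul, grComm_symb, grComm_symb, ← symb_ksmul]
      refine congrArg (symb _) (Subtype.ext ?_)
      ext x
      simp [opComm, smul_sub])

/-- The bracket of `gr D_{A/k}`, extended bilinearly from homogeneous elements. -/
def grBracket : GrDiffOp k A →ₗ[k] GrDiffOp k A →ₗ[k] GrDiffOp k A :=
  DirectSum.toModule k ℕ _ fun i =>
    (DirectSum.toModule k ℕ _ fun j =>
      ((grCommHom i j).compr₂ (DirectSum.lof k ℕ (Gr k A) (i + j - 1))).flip).flip

theorem grBracket_symbol {i j : ℕ} (P : diffOp k A i) (Q : diffOp k A j) :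
    grBracket (symbol i P) (symbol j Q) = symbol (i + j - 1) (opComm P Q) := by
  simp only [grBracket, symbol, ← DirectSum.lof_eq_of k, DirectSum.toModule_lof,
    LinearMap.flip_apply, LinearMap.compr₂_apply]
  rfl

theorem opComm_eq_zero {i j : ℕ} (h : i + j = 0) (P : diffOp k A i) (Q : diffOp k A j) :
    (opComm P Q : Module.End k A) = 0 :=
  eq_zero_of_mem_zero (commutator_mem 0 h P.2 Q.2)

theorem grBracket_skew (x y : GrDiffOp k A) : grBracket x y + grBracket y x = 0 := by
  induction x using grDiffOp_induction with
  | h i P =>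
    induction y using grDiffOp_induction with
    | h j Q =>
      rw [grBracket_symbol, grBracket_symbol]
      obtain ⟨h', e⟩ := symbol_shift (n := i + j - 1) (opComm Q P) (Or.inl (by rw [add_comm]))
      rw [e, ← symbol_add, ← symbol_zero (n := i + j - 1)]
      refine congrArg (symbol _) (Subtype.ext ?_)
      simp [opComm]
    | hadd y z hy hz =>
      rw [map_add, map_add, LinearMap.add_apply, add_add_add_comm, hy, hz, add_zero]
  | hadd x z hx hz =>
    rw [map_add, map_add, LinearMap.add_apply, add_add_add_comm, hx, hz, add_zero]

theorem grBracket_self (x : GrDiffOp k A) : grBracket x x = 0 := by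
  induction x using grDiffOp_induction with
  | h i P =>
    rw [grBracket_symbol, ← symbol_zero (n := i + i - 1)]
    refine congrArg (symbol _) (Subtype.ext ?_)
    simp [opComm]
  | hadd x y hx hy =>
    rw [map_add, map_add, LinearMap.add_apply, LinearMap.add_apply, hx, hy, zero_add, add_zero,
      add_comm, grBracket_skew]

theorem grBracket_mul (x y z : GrDiffOp k A) :
    grBracket x (y * z) = grBracket x y * z + y * grBracket x z := by
  induction x using grDiffOp_induction with
  | h i P =>
    induction y using grDiffOp_induction with
    | h j Q =>
      induction z using grDiffOp_induction with
      | h l R =>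
        rw [symbol_mul, grBracket_symbol, grBracket_symbol, grBracket_symbol, symbol_mul,
          symbol_mul]
        obtain ⟨h1, e1⟩ := symbol_shift (n := i + (j + l) - 1) (opMul (opComm P Q) R) (by
          by_cases h : i + j = 0
          · right; rw [coe_opMul, opComm_eq_zero h, zero_mul]
          · left; omega)
        obtain ⟨h2, e2⟩ := symbol_shift (n := i + (j + l) - 1) (opMul Q (opComm P R)) (by
          by_cases h : i + l = 0
          · right; rw [coe_opMul, opComm_eq_zero h, mul_zero]
          · left; omega)
        rw [e1, e2, ← symbol_add]
        refine congrArg (symbol _) (Subtype.ext ?_)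
        simp only [coe_opMul, coe_opComm, Submodule.coe_add, mul_sub, sub_mul, mul_assoc]
        abel
      | hadd z w hz hw =>
        rw [mul_add, map_add, hz, hw, map_add, mul_add, mul_add]
        abel
    | hadd y w hy hw =>
      rw [add_mul, map_add, hy, hw, map_add, add_mul, add_mul]
      abel
  | hadd x w hx hw =>
    rw [map_add, LinearMap.add_apply, LinearMap.add_apply, LinearMap.add_apply, hx, hw, add_mul,
      mul_add]
    abel

theorem symbol_bracket_bracket {i j l : ℕ} (P : diffOp k A i) (Q : diffOp k A j)
    (R : diffOp k A l) {n : ℕ} (hn : i + j + l - 2 = n) :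
    ∃ h, grBracket (symbol i P) (grBracket (symbol j Q) (symbol l R))
      = symbol n ⟨P.1 * (Q.1 * R.1 - R.1 * Q.1) - (Q.1 * R.1 - R.1 * Q.1) * P.1, h⟩ := by
  rw [grBracket_symbol, grBracket_symbol]
  refine symbol_shift (opComm P (opComm Q R)) ?_
  by_cases h : j + l = 0
  · right; rw [coe_opComm, opComm_eq_zero h, zero_mul, mul_zero, sub_zero]
  · left; omega

theorem grBracket_jacobi (x y z : GrDiffOp k A) :
    grBracket x (grBracket y z) + grBracket y (grBracket z x) + grBracket z (grBracket x y)
      = 0 := by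
  induction x using grDiffOp_induction with
  | h i P =>
    induction y using grDiffOp_induction with
    | h j Q =>
      induction z using grDiffOp_induction with
      | h l R =>
        obtain ⟨h1, e1⟩ := symbol_bracket_bracket P Q R rfl
        obtain ⟨h2, e2⟩ := symbol_bracket_bracket (n := i + j + l - 2) Q R P (by omega)
        obtain ⟨h3, e3⟩ := symbol_bracket_bracket (n := i + j + l - 2) R P Q (by omega)
        rw [e1, e2, e3, ← symbol_add, ← symbol_add, ← symbol_zero (n := i + j + l - 2)]
        refine congrArg (symbol _) (Subtype.ext ?_)
        simp only [Submodule.coe_add, Submodule.coe_zero, mul_sub, sub_mul, mul_assoc]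
        abel
      | hadd z w hz hw =>
        simp only [map_add, LinearMap.add_apply]
        rw [← add_zero (0 : GrDiffOp k A)]
        nth_rewrite 1 [← hz]
        rw [← hw]
        abel
    | hadd y w hy hw =>
      simp only [map_add, LinearMap.add_apply]
      rw [← add_zero (0 : GrDiffOp k A)]
      nth_rewrite 1 [← hy]
      rw [← hw]
      abel
  | hadd x w hx hw =>
    simp only [map_add, LinearMap.add_apply]
    rw [← add_zero (0 : GrDiffOp k A)]
    nth_rewrite 1 [← hx]
    rw [← hw]
    abel

variable (k A) in
/-- The canonical Poisson structure of `gr D_{A/k}`, determined by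
`{σ_i(P), σ_j(Q)} = σ_{i+j-1}([P, Q])`. -/
def grPoisson : PoissonStructure k (GrDiffOp k A) where
  bracket := grBracket
  bracket_self := grBracket_self
  bracket_mul := grBracket_mul
  jacobi := grBracket_jacobi

end DiffOp

/-! ### Hasse--Schmidt derivations and integrable derivations -/

section HasseSchmidt

variable (k A : Type*) [CommRing k] [CommRing A] [Algebra k A]

/-- Hasse--Schmidt derivations of `A` over `k` of length `m ∈ ℕ ∪ {∞}`. The family
`(D_n)_{n ≤ m}` is extended by `D_n = 0` for `n > m`. -/
@[ext]
structure HasseSchmidt (m : ℕ∞) where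
  coeff : ℕ → Module.End k A
  coeff_zero : coeff 0 = 1
  leibniz : ∀ n : ℕ, (n : ℕ∞) ≤ m → ∀ x y : A,
    coeff n (x * y) = ∑ p ∈ Finset.HasAntidiagonal.antidiagonal n, coeff p.1 x * coeff p.2 y
  coeff_eq_zero : ∀ n : ℕ, m < (n : ℕ∞) → coeff n = 0

variable {k A}

namespace HasseSchmidt

theorem coeff_mem {m : ℕ∞} (D : HasseSchmidt k A m) (n : ℕ) : D.coeff n ∈ diffOp k A n := by
  induction n using Nat.strong_induction_on with
  | _ n ih =>
    cases n with
    | zero => rw [D.coeff_zero]; exact one_mem_diffOp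
    | succ n =>
      rcases le_or_gt ((n + 1 : ℕ) : ℕ∞) m with h | h
      · intro a
        have e : D.coeff (n + 1) * LinearMap.mulLeft k a - LinearMap.mulLeft k a * D.coeff (n + 1)
            = ∑ p ∈ Finset.HasAntidiagonal.antidiagonal n, D.coeff (p.1 + 1) a • D.coeff p.2 := by
          ext x
          simp [D.leibniz _ h, Finset.Nat.sum_antidiagonal_succ, D.coeff_zero,
            LinearMap.sum_apply]
        rw [e]
        refine sum_mem fun p hp => Submodule.smul_mem _ _ ?_
        have hp' := Finset.HasAntidiagonal.mem_antidiagonal.1 hp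
        exact diffOpLT_mono (by omega) (ih p.2 (by omega))
      · rw [D.coeff_eq_zero _ h]
        exact zero_mem _

/-- The identity. -/
def id (m : ℕ∞) : HasseSchmidt k A m where
  coeff n := if n = 0 then 1 else 0
  coeff_zero := if_pos rfl
  leibniz n _ x y := by
    cases n with
    | zero => simp
    | succ n =>
      rw [if_neg (Nat.succ_ne_zero n), LinearMap.zero_apply]
      refine (Finset.sum_eq_zero fun p hp => ?_).symm
      have hp' := Finset.HasAntidiagonal.mem_antidiagonal.1 hp
      by_cases h : p.1 = 0
      · rw [if_neg (show p.2 ≠ 0 by omega), LinearMap.zero_apply, mul_zero]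
      · rw [if_neg h, LinearMap.zero_apply, zero_mul]
  coeff_eq_zero n h := if_neg (by rintro rfl; simp at h)

/-- The family `(a ^ n D_n)`. -/
def smul {m : ℕ∞} (a : A) (D : HasseSchmidt k A m) : HasseSchmidt k A m where
  coeff n := a ^ n • D.coeff n
  coeff_zero := by rw [pow_zero, one_smul, D.coeff_zero]
  leibniz n h x y := by
    rw [LinearMap.smul_apply, D.leibniz n h, Finset.smul_sum]
    refine Finset.sum_congr rfl fun p hp => ?_
    rw [← Finset.HasAntidiagonal.mem_antidiagonal.1 hp, LinearMap.smul_apply, LinearMap.smul_apply, pow_add,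
      smul_eq_mul, smul_eq_mul, smul_eq_mul]
    ring
  coeff_eq_zero n h := by rw [D.coeff_eq_zero n h, smul_zero]

theorem sum_antidiagonal_four {M : Type*} [AddCommMonoid M] (f : ℕ → ℕ → ℕ → ℕ → M) (n : ℕ) :
    ∑ p ∈ Finset.HasAntidiagonal.antidiagonal n, ∑ q ∈ Finset.HasAntidiagonal.antidiagonal p.1, ∑ r ∈ Finset.HasAntidiagonal.antidiagonal p.2,
        f q.1 q.2 r.1 r.2
      = ∑ p ∈ Finset.HasAntidiagonal.antidiagonal n, ∑ q ∈ Finset.HasAntidiagonal.antidiagonal p.1,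
          ∑ r ∈ Finset.HasAntidiagonal.antidiagonal p.2, f q.1 r.1 q.2 r.2 := by
  simp only [Finset.sum_sigma']
  refine Finset.sum_nbij' (fun x => ⟨(x.2.1.1 + x.2.2.1, x.2.1.2 + x.2.2.2),
    ⟨(x.2.1.1, x.2.2.1), (x.2.1.2, x.2.2.2)⟩⟩)
    (fun x => ⟨(x.2.1.1 + x.2.2.1, x.2.1.2 + x.2.2.2),
    ⟨(x.2.1.1, x.2.2.1), (x.2.1.2, x.2.2.2)⟩⟩) ?_ ?_ ?_ ?_ ?_
  · rintro ⟨⟨a, b⟩, ⟨c, d⟩, ⟨e, g⟩⟩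
    simp only [Finset.mem_sigma, Finset.HasAntidiagonal.mem_antidiagonal]
    rintro ⟨h, rfl, rfl⟩
    exact ⟨by rw [← h, add_add_add_comm], trivial, trivial⟩
  · rintro ⟨⟨a, b⟩, ⟨c, d⟩, ⟨e, g⟩⟩
    simp only [Finset.mem_sigma, Finset.HasAntidiagonal.mem_antidiagonal]
    rintro ⟨h, rfl, rfl⟩
    exact ⟨by rw [← h, add_add_add_comm], trivial, trivial⟩
  · rintro ⟨⟨a, b⟩, ⟨c, d⟩, ⟨e, g⟩⟩
    simp only [Finset.mem_sigma, Finset.HasAntidiagonal.mem_antidiagonal]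
    rintro ⟨_, rfl, rfl⟩
    rfl
  · rintro ⟨⟨a, b⟩, ⟨c, d⟩, ⟨e, g⟩⟩
    simp only [Finset.mem_sigma, Finset.HasAntidiagonal.mem_antidiagonal]
    rintro ⟨_, rfl, rfl⟩
    rfl
  · intros
    rfl

/-- The composition `(D ∘ E)_n = ∑_{i + j = n} D_i ∘ E_j`. -/
def comp {m : ℕ∞} (D E : HasseSchmidt k A m) : HasseSchmidt k A m where
  coeff n := if (n : ℕ∞) ≤ m then ∑ p ∈ Finset.HasAntidiagonal.antidiagonal n, D.coeff p.1 * E.coeff p.2 else 0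
  coeff_zero := by simp [D.coeff_zero, E.coeff_zero]
  leibniz n h x y := by
    have hle : ∀ p ∈ Finset.HasAntidiagonal.antidiagonal n, (p.1 : ℕ∞) ≤ m ∧ (p.2 : ℕ∞) ≤ m := fun p hp =>
      have hp' := Finset.HasAntidiagonal.mem_antidiagonal.1 hp
      ⟨le_trans (Nat.cast_le.2 (by omega)) h, le_trans (Nat.cast_le.2 (by omega)) h⟩
    have e1 : (∑ p ∈ Finset.HasAntidiagonal.antidiagonal n, D.coeff p.1 * E.coeff p.2) (x * y)
        = ∑ p ∈ Finset.HasAntidiagonal.antidiagonal n, ∑ q ∈ Finset.HasAntidiagonal.antidiagonal p.1,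
          ∑ r ∈ Finset.HasAntidiagonal.antidiagonal p.2,
            D.coeff q.1 (E.coeff r.1 x) * D.coeff q.2 (E.coeff r.2 y) := by
      rw [LinearMap.sum_apply]
      refine Finset.sum_congr rfl fun p hp => ?_
      rw [Module.End.mul_apply, E.leibniz _ (hle p hp).2, map_sum, Finset.sum_comm]
      exact Finset.sum_congr rfl fun r _ => D.leibniz _ (hle p hp).1 _ _
    rw [if_pos h, e1, ← sum_antidiagonal_four
      (fun a b c d => D.coeff a (E.coeff b x) * D.coeff c (E.coeff d y))]
    refine Finset.sum_congr rfl fun p hp => ?_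
    rw [if_pos (hle p hp).1, if_pos (hle p hp).2, LinearMap.sum_apply, LinearMap.sum_apply,
      Finset.sum_mul_sum]
    rfl
  coeff_eq_zero n h := if_neg (not_le.2 h)

end HasseSchmidt

variable (k A)

/-- The `A`-module `IDer_k(A; m)` of `m`-integrable derivations (meant for `m ≥ 1`): those of the
form `D_1` for a Hasse--Schmidt derivation `D` of length `m`. -/
def IDer (m : ℕ∞) : Submodule A (Derivation k A A) where
  carrier := {δ | ∃ D : HasseSchmidt k A m, D.coeff 1 = (δ : A →ₗ[k] A)}
  zero_mem' := ⟨HasseSchmidt.id m, by simp [HasseSchmidt.id]⟩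
  add_mem' := by
    rintro δ ε ⟨D, hD⟩ ⟨E, hE⟩
    refine ⟨D.comp E, ?_⟩
    rw [Derivation.coe_add_linearMap, ← hD, ← hE]
    by_cases h : ((1 : ℕ) : ℕ∞) ≤ m
    · simp only [HasseSchmidt.comp, if_pos h, Finset.Nat.antidiagonal_succ,
        Finset.Nat.antidiagonal_zero]
      simp [D.coeff_zero, E.coeff_zero, add_comm]
    · rw [HasseSchmidt.coeff_eq_zero _ _ (not_le.1 h), D.coeff_eq_zero _ (not_le.1 h),
        E.coeff_eq_zero _ (not_le.1 h), add_zero]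
  smul_mem' := by
    rintro a δ ⟨D, hD⟩
    refine ⟨D.smul a, ?_⟩
    rw [Derivation.coe_smul_linearMap, ← hD]
    simp [HasseSchmidt.smul]

/-- The `A`-module `IDer^f_k(A)` of the derivations that are `m`-integrable for all integers
`m ≥ 1`. -/
def IDerF : Submodule A (Derivation k A A) := ⨅ (m : ℕ) (_ : 1 ≤ m), IDer k A m

end HasseSchmidt

/-! ### Divided power algebras of Lie--Rinehart algebras of derivations -/

section DividedPower

variable {k A : Type*} [CommRing k] [CommRing A] [Algebra k A]

/-- The degree `n` part of the divided power algebra `Γ_A M`, where `γ_m(x)` has degree `m`. -/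
def gammaPart (A M : Type*) [CommRing A] [AddCommGroup M] [Module A M] (n : ℕ) :
    Submodule A (DividedPowerAlgebra A M) :=
  (MvPolynomial.weightedHomogeneousSubmodule A (Prod.fst : ℕ × M → ℕ) n).map
    (RingCon.mkₐ A (DividedPowerAlgebra.ringCon A M)).toLinearMap

/-- The degree `n` part of `gr D_{A/k}`. -/
def grPart (k A : Type*) [CommRing k] [CommRing A] [Algebra k A] (n : ℕ) :
    Submodule A (GrDiffOp k A) :=
  LinearMap.range (DirectSum.lof A ℕ (Gr k A) n)

/-- For a Lie--Rinehart algebra `L` of derivations of `A` (with the inclusion as anchor), the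
Poisson structure of `Γ_A L` with `{a, b} = 0`, `{γ_m(δ), a} = δ(a) γ_{m-1}(δ)` and
`{γ_m(δ), γ_n(ε)} = γ_{m-1}(δ) γ_{n-1}(ε) γ_1([δ, ε])` for `m, n ≥ 1`. -/
structure IsCanonicalPoisson (L : LieRinehartSubalgebra A (Derivation k A A))
    (P : PoissonStructure k (DividedPowerAlgebra A L)) : Prop where
  base_base : ∀ a b : A,
    P.bracket (algebraMap A (DividedPowerAlgebra A L) a) (algebraMap A _ b) = 0
  dp_base : ∀ (δ : L) (a : A) (m : ℕ),
    P.bracket (DividedPowerAlgebra.dp A (m + 1) δ) (algebraMap A _ a)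
      = (δ : Derivation k A A) a • DividedPowerAlgebra.dp A m δ
  dp_dp : ∀ (δ ε : L) (m n : ℕ),
    P.bracket (DividedPowerAlgebra.dp A (m + 1) δ) (DividedPowerAlgebra.dp A (n + 1) ε)
      = DividedPowerAlgebra.dp A m δ * DividedPowerAlgebra.dp A n ε
        * DividedPowerAlgebra.dp A 1 ⁅δ, ε⁆

/-- The graded `A`-algebra maps `θ : Γ_A L → gr D_{A/k}` such that `θ(γ_n(δ)) = σ_n(D_n)` for all
`δ ∈ L`, `n ≥ 1` and all `n`-integrals `D` of `δ`. -/
structure IsThetaF (L : LieRinehartSubalgebra A (Derivation k A A))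
    (θ : DividedPowerAlgebra A L →ₐ[A] GrDiffOp k A) : Prop where
  graded : ∀ n, ∀ x ∈ gammaPart A L n, θ x ∈ grPart k A n
  apply_dp : ∀ (δ : L) (n : ℕ), 1 ≤ n → ∀ D : HasseSchmidt k A n,
    D.coeff 1 = ((δ : Derivation k A A) : A →ₗ[k] A) →
      θ (DividedPowerAlgebra.dp A n δ) = symbol n ⟨D.coeff n, D.coeff_mem n⟩

/-- The graded `A`-algebra maps `θ : Γ_A L → gr D_{A/k}` such that `θ(γ_n(δ)) = σ_n(D_n)` for all
`δ ∈ L`, `n ≥ 1` and all `∞`-integrals `D` of `δ`. -/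
structure IsThetaInf (L : LieRinehartSubalgebra A (Derivation k A A))
    (θ : DividedPowerAlgebra A L →ₐ[A] GrDiffOp k A) : Prop where
  graded : ∀ n, ∀ x ∈ gammaPart A L n, θ x ∈ grPart k A n
  apply_dp : ∀ (δ : L) (n : ℕ), 1 ≤ n → ∀ D : HasseSchmidt k A ⊤,
    D.coeff 1 = ((δ : Derivation k A A) : A →ₗ[k] A) →
      θ (DividedPowerAlgebra.dp A n δ) = symbol n ⟨D.coeff n, D.coeff_mem n⟩

end DividedPower

end PoissonHS

end

noncomputable section

namespace PoissonHS

open DividedPowerAlgebra (dp)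

/-! ### Factorization of two-parameter families of operators -/

section Factorization

open Finset

/-! Closure under the bracket. If `D`, `E` integrate `δ`, `ε`, the family `F (i, j) = D_i E_j`
satisfies the two-parameter Leibniz rule. It factors as `F = Y X` with `Y` supported in `i ≤ j` and
`X` in `{0} ∪ {i > j}`. Both regions are closed under addition, so both factors inherit the Leibniz
rule (`IsFactorization.leibnizAt`). The diagonal is a face of `i ≤ j`, so `n ↦ Y (n, n)` is again a
Hasse–Schmidt derivation; its degree-one term is `D_1 E_1 - E_1 D_1`.

The Poisson structure on `Γ_A L`. Derivations of `Γ_A L` into a module are ring sections of a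
square-zero extension, hence are supplied by the universal property of `Γ_A L`
(`exists_derivation`). Using this first with values in `Γ_A L` and then in its module of derivations
produces `x ↦ {x, ·}`. All derivations involved satisfy `X (γ_n x) = γ_{n-1}(x) X (γ_1 x)`, so
skew-symmetry and Jacobi need checking only on `A` and `L`.

The map to `gr D_{A/k}`. A homogeneous element of positive degree whose brackets with all of `A`
vanish is zero: this is the definition of order. Since `{σ_{n+1}(D_{n+1}), a} = δ(a) σ_n(D_n)`, the
symbols depend on `δ` alone (`IsSymbolSeq.unique`). The same principle, by induction on the degree,
gives the relations of `Γ_A L` and the bracket formula (`IsSymbolSeq.mul`, `smul`, `add`,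
`bracket_bracket`). -/

instance instHasAntidiagonalProd : HasAntidiagonal (ℕ × ℕ) where
  antidiagonal p := (antidiagonal p.1 ×ˢ antidiagonal p.2).image
    fun x => ((x.1.1, x.2.1), (x.1.2, x.2.2))
  mem_antidiagonal {p q} := by
    obtain ⟨⟨a, b⟩, ⟨c, d⟩⟩ := q
    obtain ⟨m, n⟩ := p
    simp [Prod.ext_iff]

/-- Both sides run over all decompositions `n = a + b + c + d`; transposing the two inner summands
is an involution. -/
theorem sum_antidiagonal_swap {ι M : Type*} [AddCommMonoid ι] [HasAntidiagonal ι] [AddCommMonoid M]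
    (f : ι → ι → ι → ι → M) (n : ι) :
    ∑ p ∈ antidiagonal n, ∑ q ∈ antidiagonal p.1, ∑ r ∈ antidiagonal p.2, f q.1 q.2 r.1 r.2
      = ∑ p ∈ antidiagonal n, ∑ q ∈ antidiagonal p.1, ∑ r ∈ antidiagonal p.2,
        f q.1 r.1 q.2 r.2 := by
  simp only [Finset.sum_sigma']
  refine Finset.sum_nbij' (fun x => ⟨(x.2.1.1 + x.2.2.1, x.2.1.2 + x.2.2.2),
    ⟨(x.2.1.1, x.2.2.1), (x.2.1.2, x.2.2.2)⟩⟩)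
    (fun x => ⟨(x.2.1.1 + x.2.2.1, x.2.1.2 + x.2.2.2),
    ⟨(x.2.1.1, x.2.2.1), (x.2.1.2, x.2.2.2)⟩⟩) ?_ ?_ ?_ ?_ ?_
  · rintro ⟨⟨a, b⟩, ⟨c, d⟩, ⟨e, g⟩⟩
    simp only [Finset.mem_sigma, HasAntidiagonal.mem_antidiagonal]
    rintro ⟨h, rfl, rfl⟩
    exact ⟨by rw [← h, add_add_add_comm], trivial, trivial⟩
  · rintro ⟨⟨a, b⟩, ⟨c, d⟩, ⟨e, g⟩⟩
    simp only [Finset.mem_sigma, HasAntidiagonal.mem_antidiagonal]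
    rintro ⟨h, rfl, rfl⟩
    exact ⟨by rw [← h, add_add_add_comm], trivial, trivial⟩
  · rintro ⟨⟨a, b⟩, ⟨c, d⟩, ⟨e, g⟩⟩
    simp only [Finset.mem_sigma, HasAntidiagonal.mem_antidiagonal]
    rintro ⟨_, rfl, rfl⟩
    rfl
  · rintro ⟨⟨a, b⟩, ⟨c, d⟩, ⟨e, g⟩⟩
    simp only [Finset.mem_sigma, HasAntidiagonal.mem_antidiagonal]
    rintro ⟨_, rfl, rfl⟩
    rfl
  · intros
    rfl

/-- For `p ≠ 0`, a sum over the antidiagonal of `p` concentrated in the two end points. -/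
theorem sum_antidiagonal_eq_ends {M : Type*} [AddCommMonoid M] {p : ℕ × ℕ} (hp : p ≠ 0)
    (f : (ℕ × ℕ) × (ℕ × ℕ) → M)
    (h : ∀ q ∈ antidiagonal p, q.1 ≠ 0 → q.2 ≠ 0 → f q = 0) :
    ∑ q ∈ antidiagonal p, f q = f (0, p) + f (p, 0) := by
  refine Finset.sum_eq_add_of_mem _ _ (by simp) (by simp)
    (fun e => hp (congrArg Prod.snd e)) fun q hq hne => ?_
  have hq' := HasAntidiagonal.mem_antidiagonal.1 hq
  refine h q hq (fun e => hne.1 ?_) (fun e => hne.2 ?_)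
  · exact Prod.ext e (by rw [← hq', e, zero_add])
  · exact Prod.ext (by rw [← hq', e, add_zero]) e

/-- The factors in the factorization of a two-parameter family `F` with `F 0 = 1` as a product
`Y X` with `Y` supported in `i ≤ j` and `X` supported in `{0} ∪ {i > j}`, glued together. -/
def factor {R : Type*} [Ring R] (F : ℕ × ℕ → R) (p : ℕ × ℕ) : R :=
  -- At `p ≠ 0` only one of `Y p`, `X p` may be nonzero, so the two end terms of the convolution `Y
  -- X` contain a single unknown. All other terms have smaller total degree, and one recursion
  -- yields both factors.
  F p - ∑ q ∈ (antidiagonal p).attach,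
    if _h : q.1.1 ≠ 0 ∧ q.1.2 ≠ 0 ∧ q.1.1.1 ≤ q.1.1.2 ∧ q.1.2.2 < q.1.2.1 then
      factor F q.1.1 * factor F q.1.2 else 0
termination_by p.1 + p.2
decreasing_by
  all_goals
    obtain ⟨⟨⟨a, b⟩, ⟨c, d⟩⟩, hq⟩ := q
    have hq' := HasAntidiagonal.mem_antidiagonal.1 hq
    obtain ⟨m, n⟩ := p
    simp only [Prod.mk_add_mk, Prod.mk.injEq, ne_eq, Prod.mk_eq_zero] at hq' _h ⊢
    omega

theorem factor_eq {R : Type*} [Ring R] (F : ℕ × ℕ → R) (p : ℕ × ℕ) :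
    factor F p = F p - ∑ q ∈ antidiagonal p,
        if q.1 ≠ 0 ∧ q.2 ≠ 0 ∧ q.1.1 ≤ q.1.2 ∧ q.2.2 < q.2.1 then
          factor F q.1 * factor F q.2 else 0 := by
  conv_lhs => rw [factor]
  congr 1
  rw [← Finset.sum_attach (antidiagonal p)]
  exact Finset.sum_congr rfl fun q _ => by split_ifs <;> rfl

/-- `F = Y X` with `Y` supported in `i ≤ j` and `X` supported in `{0} ∪ {i > j}`, both with
constant term `1`. -/
structure IsFactorization {R : Type*} [Ring R] (F Y X : ℕ × ℕ → R) : Prop where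
  left_zero : Y 0 = 1
  right_zero : X 0 = 1
  left_eq_zero : ∀ p : ℕ × ℕ, p.2 < p.1 → Y p = 0
  right_eq_zero : ∀ p : ℕ × ℕ, p ≠ 0 → p.1 ≤ p.2 → X p = 0
  eq_sum : ∀ p, F p = ∑ q ∈ antidiagonal p, Y q.1 * X q.2

theorem antidiagonal_prod_zero : antidiagonal (0 : ℕ × ℕ) = {(0, 0)} := rfl

theorem exists_isFactorization {R : Type*} [Ring R] (F : ℕ × ℕ → R) (hF : F 0 = 1) :
    ∃ Y X, IsFactorization F Y X := by
  have h0 : factor F 0 = 1 := by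
    rw [factor_eq, antidiagonal_prod_zero]
    simp [hF]
  refine ⟨fun p => if p.1 ≤ p.2 then factor F p else 0,
    fun p => if p = 0 then 1 else if p.2 < p.1 then factor F p else 0, ?_, ?_, ?_, ?_, ?_⟩
  · simp [h0]
  · simp
  · intro p hp
    exact if_neg (by omega)
  · intro p hp hp'
    rw [if_neg hp, if_neg (by omega)]
  · intro p
    by_cases hp : p = 0
    · subst hp
      simp [h0, hF]
    -- Subtracting the interior sum from both sides turns the left side into `factor F p` and leaves
    -- only the end terms on the right.
    rw [← sub_eq_zero, ← sub_sub_sub_cancel_right _ _ (∑ q ∈ antidiagonal p,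
        if q.1 ≠ 0 ∧ q.2 ≠ 0 ∧ q.1.1 ≤ q.1.2 ∧ q.2.2 < q.2.1 then
          factor F q.1 * factor F q.2 else 0), ← factor_eq, ← Finset.sum_sub_distrib, sub_eq_zero,
      sum_antidiagonal_eq_ends hp]
    · rcases le_or_gt p.1 p.2 with h | h
      · simp [hp, h, h0, not_lt.2 h]
      · simp [hp, h, h0, not_le.2 h]
    · intro q _ h1 h2
      by_cases h3 : q.1.1 ≤ q.1.2 <;> by_cases h4 : q.2.2 < q.2.1 <;> simp [h1, h2, h3, h4]

end Factorization

/-! ### Integrable derivations are closed under the bracket -/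

section LieClosure

open Finset

variable {k A : Type*} [CommRing k] [CommRing A] [Algebra k A]

/-- The Leibniz rule in degree `p` for a family of operators. -/
def LeibnizAt {ι : Type*} [AddCommMonoid ι] [HasAntidiagonal ι] (F : ι → Module.End k A) (p : ι) :
    Prop :=
  ∀ x y : A, F p (x * y) = ∑ q ∈ antidiagonal p, F q.1 x * F q.2 y

theorem leibnizAt_zero {F : ℕ × ℕ → Module.End k A} (h : F 0 = 1) : LeibnizAt F 0 := fun x y => by
  simp [h]

/-- The factors of a family satisfying the Leibniz rule satisfy it. -/
theorem IsFactorization.leibnizAt {F Y X : ℕ × ℕ → Module.End k A} (h : IsFactorization F Y X)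
    (N : ℕ) : ∀ p : ℕ × ℕ, p.1 + p.2 = N → (∀ q ≤ p, LeibnizAt F q) →
      LeibnizAt Y p ∧ LeibnizAt X p := by
  induction N using Nat.strong_induction_on with
  | _ N ih =>
  intro p hN hF
  by_cases hp : p = 0
  · subst hp
    exact ⟨leibnizAt_zero h.left_zero, leibnizAt_zero h.right_zero⟩
  have hlt : ∀ q ∈ antidiagonal p, q.1 ≠ 0 → q.2 ≠ 0 → LeibnizAt Y q.1 ∧ LeibnizAt X q.2 := by
    rintro ⟨⟨a, b⟩, ⟨c, d⟩⟩ hq h1 h2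
    have hq' := HasAntidiagonal.mem_antidiagonal.1 hq
    obtain ⟨m, n⟩ := p
    simp only [Prod.mk_add_mk, Prod.mk.injEq, ne_eq, Prod.mk_eq_zero] at hq' h1 h2 hN ⊢
    refine ⟨(ih (a + b) (by omega) (a, b) rfl fun q hq => hF q (hq.trans ?_)).1,
      (ih (c + d) (by omega) (c, d) rfl fun q hq => hF q (hq.trans ?_)).2⟩
    · exact ⟨by simp; omega, by simp; omega⟩
    · exact ⟨by simp; omega, by simp; omega⟩
  -- The Leibniz defects of `Y` and `X` at `p` add up to zero: in the rule for `F = Y X` the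
  -- interior terms `Y_q X_r` cancel by induction, leaving the two end terms.
  have key : ∀ x y : A, Y p (x * y) + X p (x * y)
      = (∑ q ∈ antidiagonal p, Y q.1 x * Y q.2 y) + ∑ q ∈ antidiagonal p, X q.1 x * X q.2 y := by
    intro x y
    have e := hF p le_rfl x y
    have e2 : ∑ q ∈ antidiagonal p, F q.1 x * F q.2 y
        = ∑ p' ∈ antidiagonal p, ∑ q ∈ antidiagonal p'.1, ∑ r ∈ antidiagonal p'.2,
          Y q.1 (X r.1 x) * Y q.2 (X r.2 y) := by
      rw [← sum_antidiagonal_swap (fun a b c d => Y a (X b x) * Y c (X d y))]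
      refine Finset.sum_congr rfl fun q _ => ?_
      rw [h.eq_sum, h.eq_sum, LinearMap.sum_apply, LinearMap.sum_apply, Finset.sum_mul_sum]
      rfl
    rw [e2, h.eq_sum, LinearMap.sum_apply, ← sub_eq_zero, ← Finset.sum_sub_distrib,
      sum_antidiagonal_eq_ends hp] at e
    · simp only [antidiagonal_prod_zero, sum_singleton, h.left_zero, h.right_zero, one_mul,
        mul_one, Module.End.one_apply] at e
      linear_combination e
    · intro q hq h1 h2
      rw [Module.End.mul_apply, (hlt q hq h1 h2).2, map_sum, sub_eq_zero, Finset.sum_comm]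
      exact Finset.sum_congr rfl fun r _ => (hlt q hq h1 h2).1 _ _
  rcases le_or_gt p.1 p.2 with hle | hgt
  -- `{0} ∪ {i > j}` is closed under addition, so a point outside it is not a sum of two points of
  -- it. The defect of `X` therefore vanishes, and with it that of `Y`.
  · have e0 : ∀ x y : A, ∑ q ∈ antidiagonal p, X q.1 x * X q.2 y = 0 := fun x y => by
      refine Finset.sum_eq_zero fun q hq => ?_
      have hq' := HasAntidiagonal.mem_antidiagonal.1 hq
      by_cases h1 : q.1 = 0
      · rw [h.right_eq_zero q.2 (fun h2 => hp (by rw [← hq', h1, h2, add_zero]))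
          (by rw [← hq', h1, zero_add] at hle; exact hle), LinearMap.zero_apply, mul_zero]
      by_cases h2 : q.2 = 0
      · rw [h.right_eq_zero q.1 h1
          (by rw [← hq', h2, add_zero] at hle; exact hle), LinearMap.zero_apply, zero_mul]
      by_cases h3 : q.1.1 ≤ q.1.2
      · rw [h.right_eq_zero q.1 h1 h3, LinearMap.zero_apply, zero_mul]
      · rw [h.right_eq_zero q.2 h2, LinearMap.zero_apply, mul_zero]
        rw [← hq', Prod.fst_add, Prod.snd_add] at hle
        omega
    have hX : X p = 0 := h.right_eq_zero p hp hle
    refine ⟨fun x y => ?_, fun x y => by rw [e0, hX, LinearMap.zero_apply]⟩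
    have e := key x y
    rwa [e0, hX, LinearMap.zero_apply, add_zero, add_zero] at e
  -- The same argument for the region `i ≤ j`, also closed under addition.
  · have e0 : ∀ x y : A, ∑ q ∈ antidiagonal p, Y q.1 x * Y q.2 y = 0 := fun x y => by
      refine Finset.sum_eq_zero fun q hq => ?_
      have hq' := HasAntidiagonal.mem_antidiagonal.1 hq
      rw [← hq', Prod.fst_add, Prod.snd_add] at hgt
      by_cases h3 : q.1.2 < q.1.1
      · rw [h.left_eq_zero q.1 h3, LinearMap.zero_apply, zero_mul]
      · rw [h.left_eq_zero q.2 (by omega), LinearMap.zero_apply, mul_zero]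
    have hY : Y p = 0 := h.left_eq_zero p hgt
    refine ⟨fun x y => by rw [e0, hY, LinearMap.zero_apply], fun x y => ?_⟩
    have e := key x y
    rwa [e0, hY, LinearMap.zero_apply, zero_add, zero_add] at e

theorem HasseSchmidt.leibnizAt_mul {m : ℕ∞} (D E : HasseSchmidt k A m) (p : ℕ × ℕ)
    (h1 : (p.1 : ℕ∞) ≤ m) (h2 : (p.2 : ℕ∞) ≤ m) :
    LeibnizAt (fun q : ℕ × ℕ => D.coeff q.1 * E.coeff q.2) p := by
  intro x y
  simp only [Module.End.mul_apply]
  rw [E.leibniz _ h2, map_sum]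
  simp only [D.leibniz _ h1]
  rw [Finset.sum_comm, ← Finset.sum_product']
  refine Finset.sum_nbij' (fun x => ((x.1.1, x.2.1), (x.1.2, x.2.2)))
    (fun x => ((x.1.1, x.2.1), (x.1.2, x.2.2))) ?_ ?_ ?_ ?_ ?_
  · rintro ⟨⟨a, b⟩, ⟨c, d⟩⟩ h
    simp only [mem_product, HasAntidiagonal.mem_antidiagonal] at h ⊢
    exact Prod.ext h.1 h.2
  · rintro ⟨⟨a, b⟩, ⟨c, d⟩⟩ h
    simp only [mem_product, HasAntidiagonal.mem_antidiagonal] at h ⊢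
    exact ⟨congrArg Prod.fst h, congrArg Prod.snd h⟩
  all_goals intros; rfl

/-- The diagonal of a family supported in `i ≤ j` satisfies the Leibniz rule. -/
theorem LeibnizAt.diagonal {Y : ℕ × ℕ → Module.End k A}
    (hY : ∀ p : ℕ × ℕ, p.2 < p.1 → Y p = 0) {n : ℕ} (h : LeibnizAt Y (n, n)) :
    LeibnizAt (fun i => Y (i, i)) n := by
  intro x y
  simp only
  rw [h x y]
  symm
  refine Finset.sum_of_injOn (fun q => ((q.1, q.1), (q.2, q.2))) ?_ ?_ ?_ ?_
  · rintro ⟨a, b⟩ _ ⟨c, d⟩ _ e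
    simp only [Prod.mk.injEq] at e ⊢
    exact ⟨e.1.1, e.2.1⟩
  · rintro ⟨a, b⟩ e
    simp only [mem_coe, HasAntidiagonal.mem_antidiagonal, Prod.mk_add_mk,
      Prod.mk.injEq, and_self] at e ⊢
    exact e
  -- From `a + c = b + d`, `a ≤ b` and `c ≤ d` follow `a = b` and `c = d`, so only diagonal terms
  -- survive.
  · rintro ⟨⟨a, b⟩, ⟨c, d⟩⟩ h1 h2
    simp only [HasAntidiagonal.mem_antidiagonal, Prod.mk_add_mk, Prod.mk.injEq] at h1
    by_cases hab : b < a
    · rw [hY (a, b) hab, LinearMap.zero_apply, zero_mul]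
    by_cases hcd : d < c
    · rw [hY (c, d) hcd, LinearMap.zero_apply, mul_zero]
    refine absurd ⟨(a, c), ?_, ?_⟩ h2
    · simpa using h1.1
    · simp only [Prod.mk.injEq, true_and]
      omega
  · intros
    rfl

/-- The supports give `E 1 = Y (0, 1)` and `D 1 = X (1, 0)`, so the equation at `(1, 1)` reads `D 1
* E 1 = Y (1, 1) + E 1 * D 1`. -/
theorem IsFactorization.left_one_one {D E : ℕ → Module.End k A} (hD : D 0 = 1) (hE : E 0 = 1)
    {Y X : ℕ × ℕ → Module.End k A}
    (h : IsFactorization (fun q : ℕ × ℕ => D q.1 * E q.2) Y X) :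
    Y (1, 1) = D 1 * E 1 - E 1 * D 1 := by
  have a00 : antidiagonal ((0, 1) : ℕ × ℕ) = {((0, 0), (0, 1)), ((0, 1), (0, 0))} := rfl
  have a10 : antidiagonal ((1, 0) : ℕ × ℕ) = {((0, 0), (1, 0)), ((1, 0), (0, 0))} := rfl
  have a11 : antidiagonal ((1, 1) : ℕ × ℕ)
    = {((0, 0), (1, 1)), ((0, 1), (1, 0)), ((1, 0), (0, 1)), ((1, 1), (0, 0))} := rfl
  have y0 : Y (0, 0) = 1 := h.left_zero
  have x0 : X (0, 0) = 1 := h.right_zero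
  have e1 := h.eq_sum (0, 1)
  have e2 := h.eq_sum (1, 0)
  have e3 := h.eq_sum (1, 1)
  rw [a00] at e1
  rw [a10] at e2
  rw [a11] at e3
  simp [y0, x0, hD, hE, h.right_eq_zero (0, 1) (by simp) (by simp),
    h.right_eq_zero (1, 1) (by simp) (by simp), h.left_eq_zero (1, 0) (by simp)] at e1 e2 e3
  rw [e1, e2, ← e2, ← e1, e3, ← e1, ← e2]
  simp

/-- The integral of the bracket is the diagonal of the left factor, cut off beyond `m`. The length
is preserved, so the finite lengths and `∞` are treated at once. -/
theorem lie_mem_IDer {m : ℕ∞} {δ ε : Derivation k A A} (hδ : δ ∈ IDer k A m)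
    (hε : ε ∈ IDer k A m) : ⁅δ, ε⁆ ∈ IDer k A m := by
  obtain ⟨D, hD⟩ := hδ
  obtain ⟨E, hE⟩ := hε
  obtain ⟨Y, X, h⟩ := exists_isFactorization (fun q : ℕ × ℕ => D.coeff q.1 * E.coeff q.2)
    (by simp [D.coeff_zero, E.coeff_zero])
  refine ⟨⟨fun n => if (n : ℕ∞) ≤ m then Y (n, n) else 0, ?_, ?_, ?_⟩, ?_⟩
  · exact (if_pos (by simp)).trans h.left_zero
  · intro n hn x y
    have hn' : ∀ i : ℕ, i ≤ n → (i : ℕ∞) ≤ m := fun i hi => le_trans (Nat.cast_le.2 hi) hn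
    have e := LeibnizAt.diagonal h.left_eq_zero ((h.leibnizAt _ (n, n) rfl fun q hq =>
      D.leibnizAt_mul E q (hn' _ hq.1) (hn' _ hq.2)).1) x y
    rw [if_pos hn]
    refine e.trans (Finset.sum_congr rfl fun p hp => ?_)
    have hp' := HasAntidiagonal.mem_antidiagonal.1 hp
    rw [if_pos (hn' p.1 (by omega)), if_pos (hn' p.2 (by omega))]
  · intro n hn
    exact if_neg (not_le.2 hn)
  · have e := h.left_one_one D.coeff_zero E.coeff_zero
    have e' : D.coeff 1 * E.coeff 1 - E.coeff 1 * D.coeff 1 = (⁅δ, ε⁆ : Derivation k A A) := by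
      rw [hD, hE, Derivation.commutator_coe_linear_map]
      rfl
    simp only
    split_ifs with h1
    · rw [e, e']
    -- For length `0` the coefficient `D_1` is zero by convention, and so is the commutator.
    · rw [← e', D.coeff_eq_zero 1 (not_le.1 h1), zero_mul, mul_zero, sub_zero]

theorem lie_mem_IDerF {δ ε : Derivation k A A} (hδ : δ ∈ IDerF k A)
    (hε : ε ∈ IDerF k A) : ⁅δ, ε⁆ ∈ IDerF k A := by
  simp only [IDerF, Submodule.mem_iInf] at hδ hε ⊢
  exact fun m hm => lie_mem_IDer (hδ m hm) (hε m hm)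

/-- Truncation of an `∞`-integral. It lets the case `∞` reuse the construction made for `IDerF`. -/
theorem IDer_top_le_IDerF : IDer k A ⊤ ≤ IDerF k A := by
  rintro δ ⟨D, hD⟩
  simp only [IDerF, Submodule.mem_iInf]
  refine fun m hm => ⟨⟨fun n => if n ≤ m then D.coeff n else 0, ?_, ?_, ?_⟩, ?_⟩
  · simp [D.coeff_zero]
  · intro n hn x y
    have hn' : n ≤ m := Nat.cast_le.1 hn
    rw [if_pos hn', D.leibniz n le_top]
    refine Finset.sum_congr rfl fun p hp => ?_
    have hp' := HasAntidiagonal.mem_antidiagonal.1 hp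
    rw [if_pos (by omega : p.1 ≤ m), if_pos (by omega : p.2 ≤ m)]
  · intro n hn
    exact if_neg (not_le.2 (Nat.cast_lt.1 hn))
  · simp [hm, hD]

end LieClosure

/-! ### Derivations out of the divided power algebra -/

section DerivationLift

variable {k A : Type*} [CommRing k] [CommRing A] [Algebra k A]
  {L : Type*} [AddCommGroup L] [Module A L]

/-- Semilinear variant of the universal property of the divided power algebra. -/
theorem exists_ringHom {S : Type*} [CommRing S] (g : A →+* S) (f : ℕ → L → S)
    (hf_zero : ∀ x, f 0 x = 1)
    (hf_smul : ∀ (n : ℕ) (r : A) (x : L), f n (r • x) = g r ^ n * f n x)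
    (hf_mul : ∀ m n x, f m x * f n x = (m + n).choose m • f (m + n) x)
    (hf_add : ∀ n x y, f n (x + y)
      = ∑ p ∈ Finset.HasAntidiagonal.antidiagonal n, f p.1 x * f p.2 y) :
    ∃ φ : DividedPowerAlgebra A L →+* S,
      (∀ a, φ (algebraMap A _ a) = g a) ∧ ∀ n x, φ (dp A n x) = f n x := by
  -- With `S` regarded as an `A`-algebra through `g`, the semilinear statement becomes the linear
  -- one.
  let _ := g.toAlgebra
  refine ⟨(DividedPowerAlgebra.lift' (R := A) (M := L) (A := S) (f := fun p => f p.1 p.2)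
    hf_zero (fun n r x => ?_) hf_mul hf_add).toRingHom, fun a => ?_, fun n x => ?_⟩
  · rw [Algebra.smul_def, map_pow]
    exact hf_smul n r x
  · exact AlgHom.commutes _ a
  · exact DividedPowerAlgebra.lift'_apply_dp _ _ _ _ n x

/-- A ring homomorphism out of `Γ_A L` is determined by its values on `A` and the divided powers. -/
theorem ringHom_ext {S : Type*} [CommRing S] {φ ψ : (DividedPowerAlgebra A L) →+* S}
    (h : ∀ a, φ (algebraMap A _ a) = ψ (algebraMap A _ a))
    (h' : ∀ n x, φ (dp A n x) = ψ (dp A n x)) :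
    φ = ψ := by
  refine RingHom.ext fun x => ?_
  induction x using DividedPowerAlgebra.induction_on with
  | C a => exact h a
  | add x y hx hy => rw [map_add, map_add, hx, hy]
  | dp x n y hx => rw [map_mul, map_mul, hx, h']

variable (A) in
/-- The divided powers with a shift of the index, `0` for the index `0`. -/
def dpPred (n : ℕ) (x : L) : DividedPowerAlgebra A L := match n with
  | 0 => 0
  | n + 1 => dp A n x

theorem dpPred_zero (x : L) : dpPred A 0 x = 0 := rfl

theorem dpPred_succ (n : ℕ) (x : L) : dpPred A (n + 1) x = dp A n x := rfl

/-- The extra factor `r` raises `r ^ (n - 1)` to `r ^ n`, so that no exponent `n - 1` has to be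
interpreted at `n = 0`. -/
theorem dpPred_smul (n : ℕ) (r : A) (x : L) :
    dpPred A n (r • x) * algebraMap A _ r = algebraMap A _ r ^ n * dpPred A n x := by
  cases n with
  | zero => simp [dpPred_zero]
  | succ n =>
    rw [dpPred_succ, dpPred_succ, DividedPowerAlgebra.dp_smul, Algebra.smul_def, map_pow]
    ring

theorem dpPred_mul_dp_one (n : ℕ) (x : L) : dpPred A n x * dp A 1 x = n • dp A n x := by
  cases n with
  | zero => simp [dpPred_zero]
  | succ n => rw [dpPred_succ, DividedPowerAlgebra.dp_mul, Nat.choose_succ_self_right]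

/-- The formal derivative, with `γ_n' = γ_{n-1}`, of `γ_m γ_n = (m + n).choose m • γ_{m+n}`; the
coefficients match by Pascal's rule. -/
theorem dp_mul_dpPred (m n : ℕ) (x : L) :
    dp A m x * dpPred A n x + dp A n x * dpPred A m x = (m + n).choose m • dpPred A (m + n) x := by
  cases m with
  | zero =>
    cases n with
    | zero => simp [dpPred_zero]
    | succ n => simp [dpPred_zero, dpPred_succ, DividedPowerAlgebra.dp_zero]
  | succ m =>
    cases n with
    | zero => simp [dpPred_zero, dpPred_succ, DividedPowerAlgebra.dp_zero]
    | succ n =>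
      rw [dpPred_succ, dpPred_succ, DividedPowerAlgebra.dp_mul, DividedPowerAlgebra.dp_mul,
        show m + 1 + (n + 1) = (m + n + 1) + 1 by omega, dpPred_succ,
        show m + 1 + n = m + n + 1 by omega, show n + 1 + m = m + n + 1 by omega, ← add_smul]
      congr 1
      have h1 : (m + n + 1).choose (n + 1) = (m + n + 1).choose m := by
        rw [← Nat.choose_symm_of_eq_add]
        omega
      have h2 := Nat.choose_succ_succ (m + n + 1) m
      rw [h1]
      rw [show m + n + 1 + 1 = (m + n + 1).succ from rfl]
      simp only [Nat.succ_eq_add_one] at h2 ⊢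
      omega

theorem dpPred_add (n : ℕ) (x y : L) :
    dpPred A n (x + y)
      = ∑ p ∈ Finset.HasAntidiagonal.antidiagonal n, dp A p.1 x * dpPred A p.2 y := by
  cases n with
  | zero => simp [dpPred_zero]
  | succ n =>
    rw [Finset.Nat.sum_antidiagonal_succ', dpPred_succ, DividedPowerAlgebra.dp_add, dpPred_zero,
      mul_zero, zero_add]
    rfl

/-- The element of a trivial square-zero extension with given components. -/
def trivSqZeroExtMk {R M : Type*} (r : R) (m : M) : TrivSqZeroExt R M := (r, m)

theorem fst_trivSqZeroExtMk {R M : Type*} (r : R) (m : M) : (trivSqZeroExtMk r m).fst = r := rfl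

theorem snd_trivSqZeroExtMk {R M : Type*} (r : R) (m : M) : (trivSqZeroExtMk r m).snd = m := rfl

variable {M : Type*} [AddCommGroup M] [Module (DividedPowerAlgebra A L) M]
  [Module (DividedPowerAlgebra A L)ᵐᵒᵖ M] [IsCentralScalar (DividedPowerAlgebra A L) M]
  [Module k M] [IsScalarTower k (DividedPowerAlgebra A L) M]

/-- Derivations `Δ` of `Γ_A L` with `Δ (γ_{n + 1} x) = γ_n(x) Δ(γ_1(x))` and given values on `A`
and on `L`. -/
theorem exists_derivation (d : A → M) (e : L → M)
    (hd_add : ∀ a b, d (a + b) = d a + d b)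
    (hd_mul : ∀ a b, d (a * b) = algebraMap A (DividedPowerAlgebra A L) a • d b
      + algebraMap A (DividedPowerAlgebra A L) b • d a)
    (hd_base : ∀ c : k, d (algebraMap k A c) = 0)
    (he_add : ∀ x y, e (x + y) = e x + e y)
    (he_smul : ∀ (r : A) x,
      e (r • x) = algebraMap A (DividedPowerAlgebra A L) r • e x + dp A 1 x • d r) :
    ∃ Δ : Derivation k (DividedPowerAlgebra A L) M, (∀ a, Δ (algebraMap A _ a) = d a) ∧
      ∀ n x, Δ (dp A n x) = dpPred A n x • e x := by
  have hd_zero : d 0 = 0 := by simpa using hd_add 0 0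
  have hd_one : d 1 = 0 := by simpa using hd_base 1
  -- The second component of `g r ^ n`, needed for the relation `γ_n(r x) = r ^ n γ_n(x)` in the
  -- square-zero extension.
  have hd_pow : ∀ a n,
      d (a ^ (n + 1)) = (n + 1) • (algebraMap A (DividedPowerAlgebra A L) a ^ n • d a) := by
    intro a n
    induction n with
    | zero => simp
    | succ n ih =>
      rw [pow_succ, hd_mul, ih, map_pow]
      module
  -- The derivation sought is the second component of a ring section `x ↦ (x, Δ x)`. On `A` this
  -- section is `a ↦ (a, d a)`, which is why a semilinear universal property is used.
  let g : A →+* TrivSqZeroExt (DividedPowerAlgebra A L) M :=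
    { toFun := fun a => trivSqZeroExtMk (algebraMap A (DividedPowerAlgebra A L) a) (d a)
      map_one' := TrivSqZeroExt.ext (map_one _) hd_one
      map_mul' := fun a b => TrivSqZeroExt.ext (map_mul _ _ _) (by
        rw [TrivSqZeroExt.snd_mul, op_smul_eq_smul]
        exact hd_mul a b)
      map_zero' := TrivSqZeroExt.ext (map_zero _) hd_zero
      map_add' := fun a b => TrivSqZeroExt.ext (map_add _ _ _) (hd_add a b) }
  have hg_fst : ∀ a, (g a).fst = algebraMap A (DividedPowerAlgebra A L) a := fun a => rfl
  have hg_snd : ∀ a, (g a).snd = d a := fun a => rfl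
  obtain ⟨φ, hφ, hφ'⟩ := exists_ringHom (L := L) g
    (fun n x => trivSqZeroExtMk (dp A n x) (dpPred A n x • e x))
    (fun x => TrivSqZeroExt.ext DividedPowerAlgebra.dp_zero (zero_smul _ _))
    (fun n r x => by
      rw [← map_pow]
      refine TrivSqZeroExt.ext ?_ ?_
      · rw [TrivSqZeroExt.fst_mul, hg_fst, fst_trivSqZeroExtMk, fst_trivSqZeroExtMk,
          DividedPowerAlgebra.dp_smul, Algebra.smul_def]
      · rw [TrivSqZeroExt.snd_mul, op_smul_eq_smul, hg_fst, hg_snd, fst_trivSqZeroExtMk,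
          snd_trivSqZeroExtMk, snd_trivSqZeroExtMk, he_smul, smul_add, ← mul_smul, dpPred_smul,
          map_pow, ← mul_smul, ← mul_smul]
        congr 1
        cases n with
        | zero => simp [dpPred_zero, hd_one]
        | succ n =>
          have h := dpPred_mul_dp_one (A := A) (n + 1) x
          rw [dpPred_succ] at h
          rw [hd_pow, dpPred_succ, DividedPowerAlgebra.dp_smul, Algebra.smul_def, map_pow,
            mul_assoc, h]
          module)
    (fun m n x => by
      refine TrivSqZeroExt.ext DividedPowerAlgebra.dp_mul ?_
      rw [TrivSqZeroExt.snd_mul, op_smul_eq_smul, TrivSqZeroExt.snd_smul]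
      simp only [fst_trivSqZeroExtMk, snd_trivSqZeroExtMk]
      rw [← mul_smul, ← mul_smul, ← add_smul, dp_mul_dpPred, smul_assoc])
    (fun n x y => by
      refine TrivSqZeroExt.ext ?_ ?_
      · rw [TrivSqZeroExt.fst_sum]
        exact DividedPowerAlgebra.dp_add
      · rw [TrivSqZeroExt.snd_sum]
        simp only [TrivSqZeroExt.snd_mul, op_smul_eq_smul, fst_trivSqZeroExtMk,
          snd_trivSqZeroExtMk]
        rw [he_add, smul_add, Finset.sum_add_distrib, add_comm]
        congr 1
        · rw [dpPred_add, Finset.sum_smul]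
          exact Finset.sum_congr rfl fun p _ => mul_smul _ _ _
        · rw [add_comm x y, dpPred_add, Finset.sum_smul,
            ← Finset.Nat.sum_antidiagonal_swap]
          exact Finset.sum_congr rfl fun p _ => mul_smul _ _ _)
  -- `φ` is a section because it is one on generators; its second component is then a derivation.
  have hfst : ∀ x, (φ x).fst = x := by
    have h : (TrivSqZeroExt.fstHom (DividedPowerAlgebra A L) (DividedPowerAlgebra A L) M :
        TrivSqZeroExt (DividedPowerAlgebra A L) M →+* DividedPowerAlgebra A L).comp φ
        = RingHom.id (DividedPowerAlgebra A L) :=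
      ringHom_ext (fun a => by rw [RingHom.comp_apply, hφ]; rfl)
        (fun n x => by rw [RingHom.comp_apply, hφ']; rfl)
    exact fun x => RingHom.congr_fun h x
  have hmul : ∀ x y, (φ (x * y)).snd = x • (φ y).snd + y • (φ x).snd := fun x y => by
    rw [map_mul, TrivSqZeroExt.snd_mul, op_smul_eq_smul, hfst, hfst]
  refine ⟨Derivation.mk' ⟨⟨fun x => (φ x).snd, fun x y => ?_⟩, fun c x => ?_⟩ hmul,
    fun a => ?_, fun n x => ?_⟩
  · rw [map_add, TrivSqZeroExt.snd_add]
  · have h : c • x = algebraMap A (DividedPowerAlgebra A L) (algebraMap k A c) * x := by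
      rw [← Algebra.smul_def, algebraMap_smul]
    have h' : algebraMap A (DividedPowerAlgebra A L) (algebraMap k A c)
        = c • (1 : DividedPowerAlgebra A L) := by
      rw [Algebra.algebraMap_eq_smul_one, algebraMap_smul]
    simp only [RingHom.id_apply]
    rw [h, hmul, hφ]
    rw [hg_snd, hd_base, smul_zero, add_zero, h', smul_assoc, one_smul]
  · exact congrArg TrivSqZeroExt.snd (hφ a)
  · exact congrArg TrivSqZeroExt.snd (hφ' n x)

end DerivationLift

/-! ### The Poisson structure of `Γ_A L` -/

section GammaPoisson

variable {k A : Type*} [CommRing k] [CommRing A] [Algebra k A]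

/-- A derivation on `Γ_A L` is determined by its values on `A` and the divided powers. -/
theorem derivation_ext {L M : Type*} [AddCommGroup L] [Module A L] [AddCommGroup M]
    [Module (DividedPowerAlgebra A L) M] [Module k M]
    {X Y : Derivation k (DividedPowerAlgebra A L) M}
    (h : ∀ a, X (algebraMap A _ a) = Y (algebraMap A _ a))
    (h' : ∀ n x, X (dp A n x) = Y (dp A n x)) : X = Y := by
  refine Derivation.ext fun x => ?_
  induction x using DividedPowerAlgebra.induction_on with
  | C a => exact h a
  | add x y hx hy => rw [map_add, map_add, hx, hy]
  | dp x n y hx => rw [Derivation.leibniz, Derivation.leibniz, hx, h']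

section DividedPowerDerivation

variable {L : Type*} [AddCommGroup L] [Module A L]

/-- The derivations `X` of `Γ_A L` compatible with divided powers:
`X (γ_n(x)) = γ_{n - 1}(x) X (γ_1(x))`. -/
def IsDPDerivation (X : Derivation k (DividedPowerAlgebra A L) (DividedPowerAlgebra A L)) : Prop :=
  ∀ n x, X (dp A n x) = dpPred A n x * X (dp A 1 x)

variable {X Y : Derivation k (DividedPowerAlgebra A L) (DividedPowerAlgebra A L)}

theorem IsDPDerivation.ext (hX : IsDPDerivation X) (hY : IsDPDerivation Y)
    (h : ∀ a, X (algebraMap A _ a) = Y (algebraMap A _ a))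
    (h' : ∀ x, X (dp A 1 x) = Y (dp A 1 x)) : X = Y :=
  derivation_ext h fun n x => by rw [hX, hY, h']

theorem IsDPDerivation.add (hX : IsDPDerivation X) (hY : IsDPDerivation Y) :
    IsDPDerivation (X + Y) := fun n x => by
  rw [Derivation.add_apply, Derivation.add_apply, hX n, hY n, mul_add]

theorem IsDPDerivation.neg (hX : IsDPDerivation X) : IsDPDerivation (-X) := fun n x => by
  rw [Derivation.neg_apply, Derivation.neg_apply, hX n]
  ring

theorem IsDPDerivation.smul (f : DividedPowerAlgebra A L) (hX : IsDPDerivation X) :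
    IsDPDerivation (f • X) := fun n x => by
  rw [Derivation.smul_apply, Derivation.smul_apply, hX n, smul_eq_mul, smul_eq_mul,
    mul_left_comm]

/-- In `X (Y (γ_n x))` the term `γ_{n-2}(x) X(γ_1 x) Y(γ_1 x)` is symmetric in `X` and `Y`, so it
cancels in the commutator. -/
theorem IsDPDerivation.lie (hX : IsDPDerivation X) (hY : IsDPDerivation Y) :
    IsDPDerivation ⁅X, Y⁆ := fun n x => by
  cases n with
  | zero => simp [dpPred_zero, DividedPowerAlgebra.dp_zero]
  | succ n =>
    have h := hX (n + 1) x
    have h' := hY (n + 1) x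
    rw [dpPred_succ] at h h' ⊢
    rw [Derivation.commutator_apply, Derivation.commutator_apply, h, h', Derivation.leibniz,
      Derivation.leibniz, hX n, hY n]
    simp only [smul_eq_mul]
    ring

theorem isDPDerivation_of_apply_dp {c : L → DividedPowerAlgebra A L}
    (h : ∀ n x, X (dp A n x) = dpPred A n x • c x) : IsDPDerivation X := fun n x => by
  rw [h, h 1, dpPred_succ, DividedPowerAlgebra.dp_zero, one_smul, smul_eq_mul]

end DividedPowerDerivation

variable (L : LieRinehartSubalgebra A (Derivation k A A))

theorem coe_lie_apply (δ ε : L) (a : A) :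
    (⁅δ, ε⁆ : L).1 a = δ.1 (ε.1 a) - ε.1 (δ.1 a) := by
  rw [LieRinehartSubalgebra.coe_bracket]
  exact Derivation.commutator_apply ..

theorem lie_smul_right (δ ε : L) (r : A) : ⁅δ, r • ε⁆ = r • ⁅δ, ε⁆ + δ.1 r • ε := by
  refine Subtype.ext (Derivation.ext fun a => ?_)
  change (⁅δ, r • ε⁆ : L).1 a = r * (⁅δ, ε⁆ : L).1 a + δ.1 r * ε.1 a
  rw [coe_lie_apply, coe_lie_apply]
  change δ.1 (r * ε.1 a) - r * ε.1 (δ.1 a) = _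
  rw [Derivation.leibniz]
  simp only [smul_eq_mul]
  ring

theorem smul_lie_left (δ ε : L) (r : A) : ⁅r • δ, ε⁆ = r • ⁅δ, ε⁆ - ε.1 r • δ := by
  rw [← lie_skew, lie_smul_right, ← lie_skew ε δ, smul_neg]
  abel

theorem dp_one_add {L : Type*} [AddCommGroup L] [Module A L] (x y : L) :
    dp A 1 (x + y) = dp A 1 x + dp A 1 y :=
  map_add (DividedPowerAlgebra.embed A L) x y

theorem dp_one_smul {L : Type*} [AddCommGroup L] [Module A L] (r : A) (x : L) :
    dp A 1 (r • x) = algebraMap A _ r * dp A 1 x := by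
  rw [DividedPowerAlgebra.dp_smul, pow_one, Algebra.smul_def]

theorem dp_one_sub {L : Type*} [AddCommGroup L] [Module A L] (x y : L) :
    dp A 1 (x - y) = dp A 1 x - dp A 1 y :=
  map_sub (DividedPowerAlgebra.embed A L) x y

theorem dp_one_neg {L : Type*} [AddCommGroup L] [Module A L] (x : L) :
    dp A 1 (-x) = -dp A 1 x :=
  map_neg (DividedPowerAlgebra.embed A L) x

/-- The twisted linearity demanded by `exists_derivation` is the Lie–Rinehart rule `[δ, r ε] = r [δ,
ε] + δ(r) ε`. -/
theorem exists_adjoint (δ : L) :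
    ∃ X : Derivation k (DividedPowerAlgebra A L) (DividedPowerAlgebra A L),
      (∀ a, X (algebraMap A _ a) = algebraMap A _ (δ.1 a)) ∧
      ∀ n ε, X (dp A n ε) = dpPred A n ε • dp A 1 ⁅δ, ε⁆ := by
  refine exists_derivation _ _ (fun a b => by rw [map_add, map_add]) (fun a b => ?_)
    (fun c => by rw [Derivation.map_algebraMap, map_zero])
    (fun x y => by rw [lie_add, dp_one_add]) fun r x => ?_
  · rw [Derivation.leibniz]
    simp only [smul_eq_mul, map_add, map_mul]
  · rw [lie_smul_right, dp_one_add, dp_one_smul, dp_one_smul, smul_eq_mul, smul_eq_mul,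
      mul_comm (algebraMap A _ (δ.1 r))]

theorem exists_baseHamiltonian (a : A) :
    ∃ X : Derivation k (DividedPowerAlgebra A L) (DividedPowerAlgebra A L),
      (∀ b, X (algebraMap A _ b) = 0) ∧
      ∀ n ε, X (dp A n ε) = dpPred A n ε • algebraMap A _ (-(ε.1 a)) := by
  refine exists_derivation _ _ (fun a b => by rw [add_zero]) (fun a b => by simp)
    (fun c => rfl) (fun x y => ?_) fun r x => ?_
  · rw [← map_add, ← neg_add]
    rfl
  · rw [smul_zero, add_zero, smul_eq_mul, ← map_mul, mul_neg]
    rfl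

/-- The derivation `{δ, ·}` of `Γ_A L` for `δ ∈ L`. -/
def adjoint (δ : L) : Derivation k (DividedPowerAlgebra A L) (DividedPowerAlgebra A L) :=
  (exists_adjoint L δ).choose

theorem adjoint_algebraMap (δ : L) (a : A) :
    adjoint L δ (algebraMap A _ a) = algebraMap A _ (δ.1 a) :=
  (exists_adjoint L δ).choose_spec.1 a

theorem adjoint_dp (δ : L) (n : ℕ) (ε : L) :
    adjoint L δ (dp A n ε) = dpPred A n ε • dp A 1 ⁅δ, ε⁆ :=
  (exists_adjoint L δ).choose_spec.2 n ε

/-- The derivation `{a, ·}` of `Γ_A L` for `a ∈ A`. -/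
def baseHamiltonian (a : A) : Derivation k (DividedPowerAlgebra A L) (DividedPowerAlgebra A L) :=
  (exists_baseHamiltonian L a).choose

theorem baseHamiltonian_algebraMap (a b : A) : baseHamiltonian L a (algebraMap A _ b) = 0 :=
  (exists_baseHamiltonian L a).choose_spec.1 b

theorem baseHamiltonian_dp (a : A) (n : ℕ) (ε : L) :
    baseHamiltonian L a (dp A n ε) = dpPred A n ε • algebraMap A _ (-(ε.1 a)) :=
  (exists_baseHamiltonian L a).choose_spec.2 n ε

theorem isDPDerivation_adjoint (δ : L) : IsDPDerivation (adjoint L δ) :=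
  isDPDerivation_of_apply_dp (adjoint_dp L δ)

theorem isDPDerivation_baseHamiltonian (a : A) : IsDPDerivation (baseHamiltonian L a) :=
  isDPDerivation_of_apply_dp (baseHamiltonian_dp L a)

theorem dpPred_one {L : Type*} [AddCommGroup L] [Module A L] (x : L) :
    dpPred A 1 x = 1 := DividedPowerAlgebra.dp_zero

theorem adjoint_dp_one (δ ε : L) : adjoint L δ (dp A 1 ε) = dp A 1 ⁅δ, ε⁆ := by
  rw [adjoint_dp, dpPred_one, one_smul]

theorem baseHamiltonian_dp_one (a : A) (ε : L) :
    baseHamiltonian L a (dp A 1 ε) = -algebraMap A _ (ε.1 a) := by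
  rw [baseHamiltonian_dp, dpPred_one, one_smul, map_neg]

/-- A second use of `exists_derivation`, now with values in derivations of `Γ_A L`. Its twisted
linearity, `{r δ, ·} = r {δ, ·} + γ_1(δ) {r, ·}`, comes from `[r δ, ε] = r [δ, ε] - ε(r) δ`. Each
condition equates derivations compatible with divided powers, so it is tested on `A` and `L` only.
-/
theorem exists_hamiltonian :
    ∃ H : Derivation k (DividedPowerAlgebra A L)
        (Derivation k (DividedPowerAlgebra A L) (DividedPowerAlgebra A L)),
      (∀ a, H (algebraMap A _ a) = baseHamiltonian L a) ∧
      ∀ n δ, H (dp A n δ) = dpPred A n δ • adjoint L δ := by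
  refine exists_derivation (baseHamiltonian L) (adjoint L) (fun a b => ?_) (fun a b => ?_)
    (fun c => ?_) (fun x y => ?_) fun r x => ?_
  · refine (isDPDerivation_baseHamiltonian L _).ext ((isDPDerivation_baseHamiltonian L _).add
      (isDPDerivation_baseHamiltonian L _)) (fun c => ?_) (fun ε => ?_)
    · simp [baseHamiltonian_algebraMap]
    · simp [baseHamiltonian_dp_one]
      ring
  · refine (isDPDerivation_baseHamiltonian L _).ext
      (((isDPDerivation_baseHamiltonian L _).smul _).add
      ((isDPDerivation_baseHamiltonian L _).smul _)) (fun c => ?_) (fun ε => ?_)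
    · simp [baseHamiltonian_algebraMap]
    · simp only [baseHamiltonian_dp_one, Derivation.add_apply, Derivation.smul_apply,
        Derivation.leibniz, smul_eq_mul, map_add, map_mul]
      ring
  · refine (isDPDerivation_baseHamiltonian L _).ext (fun n x => by simp) (fun c => ?_)
      (fun ε => ?_)
    · simp [baseHamiltonian_algebraMap]
    · simp [baseHamiltonian_dp_one]
  · refine (isDPDerivation_adjoint L _).ext ((isDPDerivation_adjoint L _).add
      (isDPDerivation_adjoint L _)) (fun c => ?_) (fun ε => ?_)
    · rw [Derivation.add_apply, adjoint_algebraMap, adjoint_algebraMap, adjoint_algebraMap,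
        ← map_add]
      rfl
    · rw [Derivation.add_apply, adjoint_dp_one, adjoint_dp_one, adjoint_dp_one, add_lie,
        dp_one_add]
  · refine (isDPDerivation_adjoint L _).ext (((isDPDerivation_adjoint L _).smul _).add
      ((isDPDerivation_baseHamiltonian L _).smul _)) (fun c => ?_) (fun ε => ?_)
    · rw [Derivation.add_apply, Derivation.smul_apply, Derivation.smul_apply,
        adjoint_algebraMap, adjoint_algebraMap, baseHamiltonian_algebraMap, smul_zero, add_zero,
        smul_eq_mul, ← map_mul]
      rfl
    · rw [Derivation.add_apply, Derivation.smul_apply, Derivation.smul_apply,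
        adjoint_dp_one, adjoint_dp_one, baseHamiltonian_dp_one, smul_lie_left, dp_one_sub,
        dp_one_smul, dp_one_smul]
      simp only [smul_eq_mul]
      ring

/-- The map `x ↦ {x, ·}` on `Γ_A L`. -/
def hamiltonian : Derivation k (DividedPowerAlgebra A L)
    (Derivation k (DividedPowerAlgebra A L) (DividedPowerAlgebra A L)) :=
  (exists_hamiltonian L).choose

theorem hamiltonian_algebraMap (a : A) :
    hamiltonian L (algebraMap A _ a) = baseHamiltonian L a :=
  (exists_hamiltonian L).choose_spec.1 a

theorem hamiltonian_dp (n : ℕ) (δ : L) :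
    hamiltonian L (dp A n δ) = dpPred A n δ • adjoint L δ :=
  (exists_hamiltonian L).choose_spec.2 n δ

theorem hamiltonian_dp_one (δ : L) : hamiltonian L (dp A 1 δ) = adjoint L δ := by
  rw [hamiltonian_dp, dpPred_one, one_smul]

theorem isDPDerivation_hamiltonian (x : DividedPowerAlgebra A L) :
    IsDPDerivation (hamiltonian L x) := by
  induction x using DividedPowerAlgebra.induction_on with
  | C a =>
    rw [hamiltonian_algebraMap]
    exact isDPDerivation_baseHamiltonian L a
  | add x y hx hy =>
    rw [map_add]
    exact hx.add hy
  | dp x n y hx =>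
    rw [Derivation.leibniz, hamiltonian_dp]
    exact (((isDPDerivation_adjoint L y).smul _).smul _).add (hx.smul _)

/-- The map `y ↦ {y, x}` on `Γ_A L`. -/
def hamiltonianFlip (x : DividedPowerAlgebra A L) :
    Derivation k (DividedPowerAlgebra A L) (DividedPowerAlgebra A L) :=
  LinearMap.compDer (R := k) (A := DividedPowerAlgebra A L)
    { toFun := fun X : Derivation k (DividedPowerAlgebra A L) (DividedPowerAlgebra A L) => X x
      map_add' := fun _ _ => rfl
      map_smul' := fun _ _ => rfl } (hamiltonian L)

theorem hamiltonianFlip_apply (x y : DividedPowerAlgebra A L) :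
    hamiltonianFlip L x y = hamiltonian L y x := rfl

theorem isDPDerivation_hamiltonianFlip (x : DividedPowerAlgebra A L) :
    IsDPDerivation (hamiltonianFlip L x) := fun n y => by
  rw [hamiltonianFlip_apply, hamiltonianFlip_apply, hamiltonian_dp, hamiltonian_dp_one]
  rfl

theorem hamiltonian_base_base (a b : A) :
    hamiltonian L (algebraMap A _ a) (algebraMap A _ b) = 0 := by
  rw [hamiltonian_algebraMap, baseHamiltonian_algebraMap]

theorem hamiltonian_base_dp (a : A) (δ : L) :
    hamiltonian L (algebraMap A _ a) (dp A 1 δ) = -algebraMap A _ (δ.1 a) := by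
  rw [hamiltonian_algebraMap, baseHamiltonian_dp_one]

theorem hamiltonian_dp_base (δ : L) (a : A) :
    hamiltonian L (dp A 1 δ) (algebraMap A _ a) = algebraMap A _ (δ.1 a) := by
  rw [hamiltonian_dp_one, adjoint_algebraMap]

theorem hamiltonian_dp_dp (δ ε : L) :
    hamiltonian L (dp A 1 δ) (dp A 1 ε) = dp A 1 ⁅δ, ε⁆ := by
  rw [hamiltonian_dp_one, adjoint_dp_one]

/-- Both `{x, ·}` and `{·, x}` are compatible with divided powers. Thus one variable at a time is
reduced to `A` and `L`: first with `x` a generator, then with `y` fixed. -/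
theorem hamiltonian_skew (x y : DividedPowerAlgebra A L) :
    hamiltonian L x y = -hamiltonian L y x := by
  have h1 : ∀ a, hamiltonian L (algebraMap A _ a) = -hamiltonianFlip L (algebraMap A _ a) :=
    fun a => by
      refine (isDPDerivation_hamiltonian L _).ext (isDPDerivation_hamiltonianFlip L _).neg
        (fun b => ?_) fun ε => ?_
      · rw [Derivation.neg_apply, hamiltonianFlip_apply, hamiltonian_base_base,
          hamiltonian_base_base, neg_zero]
      · rw [Derivation.neg_apply, hamiltonianFlip_apply, hamiltonian_base_dp,
          hamiltonian_dp_base]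
  have h2 : ∀ δ, hamiltonian L (dp A 1 δ) = -hamiltonianFlip L (dp A 1 δ) :=
    fun δ => by
      refine (isDPDerivation_hamiltonian L _).ext (isDPDerivation_hamiltonianFlip L _).neg
        (fun b => ?_) fun ε => ?_
      · rw [Derivation.neg_apply, hamiltonianFlip_apply, hamiltonian_base_dp,
          hamiltonian_dp_base, neg_neg]
      · rw [Derivation.neg_apply, hamiltonianFlip_apply, hamiltonian_dp_dp,
          hamiltonian_dp_dp, ← dp_one_neg, lie_skew]
  have h3 : hamiltonianFlip L y = -hamiltonian L y := by
    refine (isDPDerivation_hamiltonianFlip L _).ext (isDPDerivation_hamiltonian L _).neg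
      (fun a => ?_) fun δ => ?_
    · rw [hamiltonianFlip_apply, h1]
      rfl
    · rw [hamiltonianFlip_apply, h2]
      rfl
  rw [← hamiltonianFlip_apply, h3]
  rfl

/-- Skew-symmetry does not give this when `2` is a zero divisor; on divided powers it rests on `[δ,
δ] = 0`. -/
theorem hamiltonian_self (x : DividedPowerAlgebra A L) : hamiltonian L x x = 0 := by
  induction x using DividedPowerAlgebra.induction_on with
  | C a => exact hamiltonian_base_base L a a
  | add x y hx hy =>
    rw [map_add (hamiltonian L), Derivation.add_apply, map_add, map_add, hx, hy,
      hamiltonian_skew L x y]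
    abel
  | dp x n y hx =>
    have hy : hamiltonian L (dp A n y) (dp A n y) = 0 := by
      rw [hamiltonian_dp, Derivation.smul_apply, adjoint_dp, lie_self]
      rw [DividedPowerAlgebra.dp_null_of_ne_zero one_ne_zero, smul_zero, smul_zero]
    rw [(hamiltonian L).leibniz, Derivation.add_apply, Derivation.smul_apply,
      Derivation.smul_apply, Derivation.leibniz, Derivation.leibniz, hx, hy, hamiltonian_skew L x]
    simp only [smul_eq_mul]
    ring

/-- The Jacobiator of the bracket. -/
def jacobiator (x y z : DividedPowerAlgebra A L) : DividedPowerAlgebra A L :=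
  hamiltonian L x (hamiltonian L y z) + hamiltonian L y (hamiltonian L z x)
    + hamiltonian L z (hamiltonian L x y)

theorem jacobiator_rotate (x y z : DividedPowerAlgebra A L) :
    jacobiator L x y z = jacobiator L y z x := by
  rw [jacobiator, jacobiator]
  abel

/-- For fixed `x`, `y` the Jacobiator is a difference of two derivations compatible with divided
powers, so its vanishing in `z` can be tested on generators. -/
theorem jacobiator_eq (x y z : DividedPowerAlgebra A L) :
    jacobiator L x y z = (⁅hamiltonian L x, hamiltonian L y⁆
      - hamiltonian L (hamiltonian L x y)) z := by
  rw [Derivation.sub_apply, Derivation.commutator_apply, jacobiator,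
    hamiltonian_skew L z x, map_neg, hamiltonian_skew L z (hamiltonian L x y)]
  abel

theorem jacobiator_eq_zero_of_generators (x y : DividedPowerAlgebra A L)
    (h : ∀ a, jacobiator L x y (algebraMap A _ a) = 0)
    (h' : ∀ δ, jacobiator L x y (dp A 1 δ) = 0) (z : DividedPowerAlgebra A L) :
    jacobiator L x y z = 0 := by
  simp only [jacobiator_eq, Derivation.sub_apply, sub_eq_zero] at h h' ⊢
  rw [((isDPDerivation_hamiltonian L x).lie (isDPDerivation_hamiltonian L y)).ext
    (isDPDerivation_hamiltonian L _) h h']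

theorem jacobiator_dp_dp_dp (δ ε ζ : L) :
    jacobiator L (dp A 1 δ) (dp A 1 ε) (dp A 1 ζ) = 0 := by
  simp only [jacobiator, hamiltonian_dp_dp]
  rw [← dp_one_add, ← dp_one_add, lie_jacobi,
    DividedPowerAlgebra.dp_null_of_ne_zero one_ne_zero]

theorem jacobiator_dp_dp_base (δ ε : L) (a : A) :
    jacobiator L (dp A 1 δ) (dp A 1 ε) (algebraMap A _ a) = 0 := by
  simp only [jacobiator, hamiltonian_dp_dp, hamiltonian_dp_base, hamiltonian_base_dp, map_neg]
  rw [coe_lie_apply, map_sub]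
  abel

theorem jacobiator_dp_base_base (δ : L) (a b : A) :
    jacobiator L (dp A 1 δ) (algebraMap A _ a) (algebraMap A _ b) = 0 := by
  simp only [jacobiator, hamiltonian_base_base, hamiltonian_dp_base, hamiltonian_base_dp, map_neg,
    map_zero, neg_zero, add_zero]

theorem jacobiator_base_base_base (a b c : A) :
    jacobiator L (algebraMap A _ a) (algebraMap A _ b) (algebraMap A _ c) = 0 := by
  simp only [jacobiator, hamiltonian_base_base, map_zero, add_zero]

theorem jacobiator_eq_zero (x y z : DividedPowerAlgebra A L) : jacobiator L x y z = 0 := by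
  have h1 : ∀ (a b : A) z, jacobiator L (algebraMap A _ a) (algebraMap A _ b) z = 0 := fun a b =>
    jacobiator_eq_zero_of_generators L _ _ (fun c => jacobiator_base_base_base L a b c) fun δ => by
      rw [← jacobiator_rotate, jacobiator_dp_base_base]
  have h2 : ∀ (δ : L) (b : A) z, jacobiator L (dp A 1 δ) (algebraMap A _ b) z = 0 := fun δ b =>
    jacobiator_eq_zero_of_generators L _ _ (fun c => jacobiator_dp_base_base L δ b c) fun ε => by
      rw [← jacobiator_rotate, jacobiator_dp_dp_base]
  have h3 : ∀ (δ : L) (b : A) z, jacobiator L (algebraMap A _ b) (dp A 1 δ) z = 0 := fun δ b =>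
    jacobiator_eq_zero_of_generators L _ _ (fun c => by
      rw [jacobiator_rotate, jacobiator_dp_base_base]) fun ε => by
      rw [jacobiator_rotate, jacobiator_dp_dp_base]
  have h4 : ∀ (δ ε : L) z, jacobiator L (dp A 1 δ) (dp A 1 ε) z = 0 := fun δ ε =>
    jacobiator_eq_zero_of_generators L _ _ (jacobiator_dp_dp_base L δ ε)
      (jacobiator_dp_dp_dp L δ ε)
  -- So far two arguments were generators. Cyclic rotation brings each remaining argument to the
  -- last place, where it too is reduced to generators.
  have h5 : ∀ (a : A) y z, jacobiator L y (algebraMap A _ a) z = 0 := fun a y z => by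
    rw [jacobiator_rotate]
    refine jacobiator_eq_zero_of_generators L _ _ (fun b => ?_) (fun δ => ?_) y <;>
      rw [← jacobiator_rotate]
    · exact h1 b a z
    · exact h2 δ a z
  have h6 : ∀ (δ : L) y z, jacobiator L y (dp A 1 δ) z = 0 := fun δ y z => by
    rw [jacobiator_rotate]
    refine jacobiator_eq_zero_of_generators L _ _ (fun b => ?_) (fun ε => ?_) y <;>
      rw [← jacobiator_rotate]
    · exact h3 δ b z
    · exact h4 ε δ z
  rw [jacobiator_rotate]
  refine jacobiator_eq_zero_of_generators L _ _ (fun a => ?_) (fun δ => ?_) x <;>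
    rw [jacobiator_rotate]
  · exact h5 a z y
  · exact h6 δ z y

/-- The canonical Poisson structure of `Γ_A L`. -/
def gammaPoisson : PoissonStructure k (DividedPowerAlgebra A L) where
  bracket := LinearMap.mk₂ k (fun x y => hamiltonian L x y)
    (fun x x' y => by rw [map_add, Derivation.add_apply])
    (fun c x y => by rw [Derivation.map_smul, Derivation.smul_apply])
    (fun x y y' => map_add _ _ _)
    (fun c x y => Derivation.map_smul _ _ _)
  bracket_self := hamiltonian_self L
  bracket_mul x y z := by
    simp only [LinearMap.mk₂_apply, Derivation.leibniz, smul_eq_mul]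
    ring
  jacobi := jacobiator_eq_zero L

theorem gammaPoisson_bracket (x y : DividedPowerAlgebra A L) :
    (gammaPoisson L).bracket x y = hamiltonian L x y := rfl

theorem isCanonicalPoisson_gammaPoisson : IsCanonicalPoisson L (gammaPoisson L) where
  base_base := hamiltonian_base_base L
  dp_base δ a m := by
    rw [gammaPoisson_bracket, hamiltonian_dp, Derivation.smul_apply, adjoint_algebraMap,
      dpPred_succ, smul_eq_mul, mul_comm, Algebra.smul_def]
  dp_dp δ ε m n := by
    rw [gammaPoisson_bracket, hamiltonian_dp, Derivation.smul_apply, adjoint_dp,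
      dpPred_succ, dpPred_succ, smul_eq_mul, smul_eq_mul, mul_assoc]

end GammaPoisson

/-! ### Poisson identities and Poisson maps out of `Γ_A L` -/

namespace PoissonStructure

variable {k B : Type*} [CommRing k] [CommRing B] [Algebra k B] (P : PoissonStructure k B)

theorem bracket_skew (x y : B) : P.bracket x y = -P.bracket y x := by
  have h := P.bracket_self (x + y)
  rw [map_add, map_add, LinearMap.add_apply, LinearMap.add_apply, P.bracket_self, P.bracket_self,
    zero_add, add_zero] at h
  exact eq_neg_of_add_eq_zero_left (by rw [add_comm]; exact h)

theorem bracket_one_right (x : B) : P.bracket x 1 = 0 := by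
  have h := P.bracket_mul x 1 1
  rw [mul_one, mul_one, one_mul] at h
  exact left_eq_add.1 h

theorem bracket_one_left (x : B) : P.bracket 1 x = 0 := by
  rw [P.bracket_skew, P.bracket_one_right, neg_zero]

theorem mul_bracket (x y z : B) :
    P.bracket (x * y) z = x * P.bracket y z + y * P.bracket x z := by
  rw [P.bracket_skew, P.bracket_mul, P.bracket_skew z x, P.bracket_skew z y]
  ring

theorem bracket_bracket (x y z : B) :
    P.bracket (P.bracket x y) z = P.bracket x (P.bracket y z) - P.bracket y (P.bracket x z) := by
  have h := P.jacobi x y z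
  rw [P.bracket_skew z x, map_neg, P.bracket_skew z] at h
  linear_combination -h

end PoissonStructure

section GammaMaps

variable {k A : Type*} [CommRing k] [CommRing A] [Algebra k A]

/-- A ring homomorphism out of a divided power algebra is a Poisson map if it is compatible with
the brackets of the elements of `A` and the divided powers. -/
theorem isPoissonMap_of_generators {L C : Type*} [AddCommGroup L] [Module A L] [CommRing C]
    [Algebra k C] (P : PoissonStructure k (DividedPowerAlgebra A L)) (Q : PoissonStructure k C)
    (θ : DividedPowerAlgebra A L →+* C)
    (h1 : ∀ a b, θ (P.bracket (algebraMap A _ a) (algebraMap A _ b))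
      = Q.bracket (θ (algebraMap A _ a)) (θ (algebraMap A _ b)))
    (h2 : ∀ n x a, θ (P.bracket (dp A n x) (algebraMap A _ a))
      = Q.bracket (θ (dp A n x)) (θ (algebraMap A _ a)))
    (h3 : ∀ m n x y, θ (P.bracket (dp A m x) (dp A n y))
      = Q.bracket (θ (dp A m x)) (θ (dp A n y))) :
    IsPoissonMap P Q θ := by
  -- For fixed `x` both sides are derivations in `y` along `θ`, so agreement spreads from
  -- generators.
  have ext : ∀ x, (∀ a, θ (P.bracket x (algebraMap A _ a))
      = Q.bracket (θ x) (θ (algebraMap A _ a))) →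
      (∀ n y, θ (P.bracket x (dp A n y)) = Q.bracket (θ x) (θ (dp A n y))) →
      ∀ y, θ (P.bracket x y) = Q.bracket (θ x) (θ y) := by
    intro x h h' y
    induction y using DividedPowerAlgebra.induction_on with
    | C a => exact h a
    | add y z hy hz => rw [map_add, map_add, map_add, map_add, hy, hz]
    | dp y n z hy =>
      rw [P.bracket_mul, map_mul, Q.bracket_mul, map_add, map_mul, map_mul, hy, h']
  have skew : ∀ x y, θ (P.bracket x y) = Q.bracket (θ x) (θ y) →
      θ (P.bracket y x) = Q.bracket (θ y) (θ x) := fun x y h => by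
    rw [P.bracket_skew, map_neg, h, Q.bracket_skew (θ y)]
  -- Extend in the second variable for a generator in the first, flip by skew-symmetry, and extend
  -- again.
  intro x
  exact ext x (fun a => skew _ _ (ext _ (h1 a) (fun n y => skew _ _ (h2 n y a)) x))
    (fun n y => skew _ _ (ext _ (h2 n y) (fun m z => h3 n m y z) x))

/-- The identity is a Poisson map by the test on generators; brackets with `γ_0 = 1` vanish in any
Poisson structure. -/
theorem IsCanonicalPoisson.eq {L : LieRinehartSubalgebra A (Derivation k A A)}
    {P P' : PoissonStructure k (DividedPowerAlgebra A L)} (h : IsCanonicalPoisson L P)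
    (h' : IsCanonicalPoisson L P') : P' = P := by
  have key : IsPoissonMap P P' (RingHom.id (DividedPowerAlgebra A L)) := by
    refine isPoissonMap_of_generators P P' _ (fun a b => ?_) (fun n x a => ?_)
      (fun m n x y => ?_) <;> simp only [RingHom.id_apply]
    · rw [h.base_base, h'.base_base]
    · cases n with
      | zero =>
        rw [DividedPowerAlgebra.dp_zero, P.bracket_one_left, P'.bracket_one_left]
      | succ n => rw [h.dp_base, h'.dp_base]
    · cases m with
      | zero => rw [DividedPowerAlgebra.dp_zero, P.bracket_one_left, P'.bracket_one_left]
      | succ m =>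
        cases n with
        | zero => rw [DividedPowerAlgebra.dp_zero, P.bracket_one_right, P'.bracket_one_right]
        | succ n => rw [h.dp_dp, h'.dp_dp]
  exact PoissonStructure.ext (LinearMap.ext₂ fun x y => (key x y).symm)

end GammaMaps

/-! ### Symbols of integrals as sequences in `gr D_{A/k}` -/

section SymbolSequence

open Finset.HasAntidiagonal (antidiagonal mem_antidiagonal)

variable {k A : Type*} [CommRing k] [CommRing A] [Algebra k A]

theorem one_eq_symbol : (1 : GrDiffOp k A) = symbol 0 ⟨1, one_mem_diffOp⟩ := rfl

theorem algebraMap_mul_symbol (a : A) {n : ℕ} (P : diffOp k A n) :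
    algebraMap A (GrDiffOp k A) a * symbol n P = symbol n (a • P) := by
  rw [← Algebra.smul_def, symbol, symbol, ← DirectSum.lof_eq_of A, ← DirectSum.lof_eq_of A,
    ← map_smul, map_smul (symb n)]

theorem smul_eq_algebraMap_mul (a : A) (x : GrDiffOp k A) : a • x = algebraMap A _ a * x :=
  Algebra.smul_def a x

theorem symbol_mem_grPart {n : ℕ} (P : diffOp k A n) : symbol n P ∈ grPart k A n :=
  ⟨symb n P, rfl⟩

theorem exists_symbol_of_mem_grPart {n : ℕ} {x : GrDiffOp k A} (hx : x ∈ grPart k A n) :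
    ∃ P : diffOp k A n, x = symbol n P := by
  obtain ⟨y, rfl⟩ := hx
  obtain ⟨P, rfl⟩ := symb_surjective _ y
  exact ⟨P, rfl⟩

instance instGradedMonoidGrPart : SetLike.GradedMonoid (grPart k A) where
  one_mem := by
    rw [one_eq_symbol]
    exact symbol_mem_grPart _
  mul_mem i j x y hx hy := by
    obtain ⟨P, rfl⟩ := exists_symbol_of_mem_grPart hx
    obtain ⟨Q, rfl⟩ := exists_symbol_of_mem_grPart hy
    rw [symbol_mul]
    exact symbol_mem_grPart _

theorem algebraMap_mul_mem_grPart (a : A) {n : ℕ} {x : GrDiffOp k A} (hx : x ∈ grPart k A n) :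
    algebraMap A (GrDiffOp k A) a * x ∈ grPart k A n := by
  rw [← Algebra.smul_def]
  exact Submodule.smul_mem _ _ hx

theorem bracket_mem_grPart {i j : ℕ} {x y : GrDiffOp k A} (hx : x ∈ grPart k A i)
    (hy : y ∈ grPart k A j) : (grPoisson k A).bracket x y ∈ grPart k A (i + j - 1) := by
  obtain ⟨P, rfl⟩ := exists_symbol_of_mem_grPart hx
  obtain ⟨Q, rfl⟩ := exists_symbol_of_mem_grPart hy
  exact (grBracket_symbol P Q).symm ▸ symbol_mem_grPart _

theorem symbol_eq_zero_iff {n : ℕ} {P : diffOp k A n} :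
    symbol n P = 0 ↔ (P : Module.End k A) ∈ diffOpLT k A n := by
  rw [symbol, ← map_zero (DirectSum.of (Gr k A) n), (DirectSum.of_injective n).eq_iff,
    ← map_zero (symb n), symb_eq_iff, Submodule.coe_zero, sub_zero]

theorem symbol_congr {n : ℕ} {P Q : diffOp k A n}
    (h : (P : Module.End k A) - Q ∈ diffOpLT k A n) : symbol n P = symbol n Q :=
  congrArg (DirectSum.of (Gr k A) n) (symb_eq_iff.2 h)

theorem bracket_algebraMap_algebraMap (a b : A) :
    (grPoisson k A).bracket (algebraMap A _ a) (algebraMap A _ b) = 0 := by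
  refine (grBracket_symbol _ _).trans (symbol_eq_zero_iff.2 ?_)
  rw [opComm_eq_zero (by rfl)]
  exact zero_mem _

/-- A homogeneous element of positive degree that commutes with `A` is zero. -/
theorem eq_zero_of_bracket_eq_zero {n : ℕ} {x : GrDiffOp k A} (hx : x ∈ grPart k A (n + 1))
    (h : ∀ a, (grPoisson k A).bracket x (algebraMap A _ a) = 0) : x = 0 := by
  obtain ⟨P, rfl⟩ := exists_symbol_of_mem_grPart hx
  -- `P` has order `< n + 1` exactly when every `[P, a]` has order `< n`, that is, when all
  -- `{σ_{n+1}(P), a}` vanish.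
  rw [symbol_eq_zero_iff, mem_diffOpLT_succ]
  intro a
  exact symbol_eq_zero_iff.1 ((grBracket_symbol P ⟨_, mulLeft_mem_diffOp a⟩).symm.trans (h a))

theorem eq_of_bracket_eq {n : ℕ} {x y : GrDiffOp k A} (hx : x ∈ grPart k A (n + 1))
    (hy : y ∈ grPart k A (n + 1)) (h : ∀ a, (grPoisson k A).bracket x (algebraMap A _ a)
      = (grPoisson k A).bracket y (algebraMap A _ a)) : x = y :=
  sub_eq_zero.1 (eq_zero_of_bracket_eq_zero (sub_mem hx hy) fun a => by
    rw [map_sub, LinearMap.sub_apply, h, sub_self])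

theorem bracket_algebraMap_mul (a b : A) (x : GrDiffOp k A) :
    (grPoisson k A).bracket (algebraMap A _ a * x) (algebraMap A _ b)
      = algebraMap A _ a * (grPoisson k A).bracket x (algebraMap A _ b) := by
  rw [PoissonStructure.mul_bracket, bracket_algebraMap_algebraMap, mul_zero, add_zero]

/-- Up to the index `N`, the sequence `s` behaves like the sequence of the symbols of an integral
of `δ`. -/
structure IsSymbolSeq (δ : Derivation k A A) (N : ℕ∞) (s : ℕ → GrDiffOp k A) : Prop where
  zero : s 0 = 1
  mem : ∀ n : ℕ, n ≤ N → s n ∈ grPart k A n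
  bracket : ∀ n : ℕ, ((n + 1 : ℕ) : ℕ∞) ≤ N → ∀ a,
    (grPoisson k A).bracket (s (n + 1)) (algebraMap A _ a) = algebraMap A _ (δ a) * s n

theorem IsSymbolSeq.mono {δ : Derivation k A A} {N N' : ℕ∞} {s : ℕ → GrDiffOp k A}
    (h : IsSymbolSeq δ N s) (hN : N' ≤ N) : IsSymbolSeq δ N' s :=
  ⟨h.zero, fun n hn => h.mem n (hn.trans hN), fun n hn => h.bracket n (hn.trans hN)⟩

/-- Bracketing with `A` lowers the degree and determines each term from the preceding one. This is
the independence of the chosen integral. -/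
theorem IsSymbolSeq.unique {δ : Derivation k A A} {N : ℕ∞} {s t : ℕ → GrDiffOp k A}
    (hs : IsSymbolSeq δ N s) (ht : IsSymbolSeq δ N t) (n : ℕ) (hn : n ≤ N) : s n = t n := by
  induction n with
  | zero => rw [hs.zero, ht.zero]
  | succ n ih =>
    refine eq_of_bracket_eq (hs.mem _ hn) (ht.mem _ hn) fun a => ?_
    rw [hs.bracket n hn, ht.bracket n hn, ih (le_trans (Nat.cast_le.2 n.le_succ) hn)]

theorem HasseSchmidt.commutator_coeff_succ {m : ℕ∞} (D : HasseSchmidt k A m) (n : ℕ)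
    (h : ((n + 1 : ℕ) : ℕ∞) ≤ m) (a : A) :
    D.coeff (n + 1) * LinearMap.mulLeft k a - LinearMap.mulLeft k a * D.coeff (n + 1)
      = ∑ p ∈ antidiagonal n, D.coeff (p.1 + 1) a • D.coeff p.2 := by
  ext x
  simp [D.leibniz _ h, Finset.Nat.sum_antidiagonal_succ, D.coeff_zero, LinearMap.sum_apply]

/-- In `[D_{n+1}, a] = ∑_{i+j=n} D_{i+1}(a) D_j` only the term `i = 0` is not of order `< n`; it is
`δ(a) D_n`. -/
theorem HasseSchmidt.isSymbolSeq {m : ℕ∞} (D : HasseSchmidt k A m) {δ : Derivation k A A}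
    (h : D.coeff 1 = (δ : A →ₗ[k] A)) :
    IsSymbolSeq δ m (fun n => symbol n ⟨D.coeff n, D.coeff_mem n⟩) where
  zero := congrArg (symbol 0) (Subtype.ext D.coeff_zero)
  mem n _ := symbol_mem_grPart _
  bracket n hn a := by
    refine (grBracket_symbol _ _).trans ?_
    rw [algebraMap_mul_symbol]
    refine symbol_congr ?_
    rw [coe_opComm]
    simp only [Submodule.coe_smul]
    rw [D.commutator_coeff_succ n hn, show n + 1 + 0 - 1 = n from rfl]
    have e : D.coeff 1 a = δ a := by rw [h]; rfl
    cases n with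
    | zero => simp [e]
    | succ n =>
      rw [Finset.Nat.sum_antidiagonal_succ, zero_add, e, add_sub_cancel_left]
      refine sum_mem fun p hp => Submodule.smul_mem _ _ ?_
      have hp' := mem_antidiagonal.1 hp
      exact diffOpLT_mono (by omega) (D.coeff_mem p.2)

/-- Integrals of different finite lengths need not extend one another, but by uniqueness their
symbols agree, so a diagonal choice works. -/
theorem exists_isSymbolSeq {δ : Derivation k A A} (h : δ ∈ IDerF k A) :
    ∃ s, IsSymbolSeq δ ⊤ s := by
  simp only [IDerF, Submodule.mem_iInf] at h
  have h' : ∀ n : ℕ, ∃ s, IsSymbolSeq δ (n + 1 : ℕ) s := fun n => by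
    obtain ⟨D, hD⟩ := h (n + 1) (Nat.le_add_left 1 n)
    exact ⟨_, D.isSymbolSeq hD⟩
  choose s hs using h'
  refine ⟨fun n => s n n, (hs 0).zero, fun n _ => (hs n).mem n (Nat.cast_le.2 n.le_succ),
    fun n _ a => ?_⟩
  rw [(hs (n + 1)).bracket n (Nat.cast_le.2 (Nat.le_succ _)),
    ((hs (n + 1)).mono (Nat.cast_le.2 (Nat.le_succ _))).unique (hs n) n
      (Nat.cast_le.2 n.le_succ)]

/-- The shift of a sequence by one, starting with `0`. -/
def shift (s : ℕ → GrDiffOp k A) : ℕ → GrDiffOp k A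
  | 0 => 0
  | n + 1 => s n

theorem shift_zero (s : ℕ → GrDiffOp k A) : shift s 0 = 0 := rfl

theorem shift_succ (s : ℕ → GrDiffOp k A) (n : ℕ) : shift s (n + 1) = s n := rfl

namespace IsSymbolSeq

variable {δ ε : Derivation k A A} {s t u : ℕ → GrDiffOp k A}

theorem bracket_eq_shift (hs : IsSymbolSeq δ ⊤ s) (n : ℕ) (a : A) :
    (grPoisson k A).bracket (s n) (algebraMap A _ a) = algebraMap A _ (δ a) * shift s n := by
  cases n with
  | zero => rw [hs.zero, PoissonStructure.bracket_one_left, shift_zero, mul_zero]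
  | succ n => exact hs.bracket n le_top a

/-- Bracketing with `a` gives `δ(a)` times the instances `(m - 1, n)` and `(m, n - 1)`; their
coefficients add by Pascal's rule. -/
theorem mul (hs : IsSymbolSeq δ ⊤ s) (N : ℕ) :
    ∀ m n, m + n = N → s m * s n = (m + n).choose m • s (m + n) := by
  induction N with
  | zero =>
    intro m n h
    obtain ⟨rfl, rfl⟩ : m = 0 ∧ n = 0 := by omega
    simp [hs.zero]
  | succ N ih =>
    rintro (_ | m) (_ | n) h
    · omega
    · simp [hs.zero]
    · simp [hs.zero]
    · have e : m + 1 + (n + 1) = m + n + 1 + 1 := by omega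
      refine eq_of_bracket_eq (n := m + n + 1) (e ▸ SetLike.mul_mem_graded (hs.mem _ le_top)
        (hs.mem _ le_top)) (nsmul_mem (e ▸ hs.mem _ le_top) _) fun a => ?_
      have h1 := ih m (n + 1) (by omega)
      have h2 := ih (m + 1) n (by omega)
      rw [show m + (n + 1) = m + n + 1 by omega] at h1
      rw [show m + 1 + n = m + n + 1 by omega] at h2
      rw [e, PoissonStructure.mul_bracket, map_nsmul, LinearMap.smul_apply,
        hs.bracket _ le_top, hs.bracket _ le_top, hs.bracket _ le_top,
        Nat.choose_succ_succ (m + n + 1) m, add_smul]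
      simp only [nsmul_eq_mul, Nat.succ_eq_add_one] at h1 h2 ⊢
      linear_combination algebraMap A (GrDiffOp k A) (δ a) * (h1 + h2)

/-- Combined with `unique`, this lemma and `add` give the relations for `γ_n(r δ)` and `γ_n(δ + ε)`.
-/
theorem smul (hs : IsSymbolSeq δ ⊤ s) (r : A) :
    IsSymbolSeq (r • δ) ⊤ (fun n => r ^ n • s n) where
  zero := by rw [pow_zero, smul_eq_algebraMap_mul, map_one, one_mul, hs.zero]
  mem n _ := Submodule.smul_mem _ _ (hs.mem n le_top)
  bracket n _ a := by
    rw [smul_eq_algebraMap_mul, bracket_algebraMap_mul, hs.bracket n le_top,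
      smul_eq_algebraMap_mul,
      Derivation.smul_apply, smul_eq_mul]
    simp only [map_mul, map_pow]
    ring

theorem add (hs : IsSymbolSeq δ ⊤ s) (ht : IsSymbolSeq ε ⊤ t) :
    IsSymbolSeq (δ + ε) ⊤ (fun n => ∑ p ∈ antidiagonal n, s p.1 * t p.2) where
  zero := by simp [hs.zero, ht.zero]
  mem n _ := sum_mem fun p hp => by
    rw [← mem_antidiagonal.1 hp]
    exact SetLike.mul_mem_graded (hs.mem _ le_top) (ht.mem _ le_top)
  bracket n _ a := by
    have e1 : ∑ p ∈ antidiagonal (n + 1), s p.1 * shift t p.2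
        = ∑ p ∈ antidiagonal n, s p.1 * t p.2 := by
      rw [Finset.Nat.sum_antidiagonal_succ', shift_zero, mul_zero, zero_add]
      rfl
    have e2 : ∑ p ∈ antidiagonal (n + 1), shift s p.1 * t p.2
        = ∑ p ∈ antidiagonal n, s p.1 * t p.2 := by
      rw [Finset.Nat.sum_antidiagonal_succ, shift_zero, zero_mul, zero_add]
      rfl
    have e3 : ∀ p ∈ antidiagonal (n + 1),
        (grPoisson k A).bracket (s p.1 * t p.2) (algebraMap A _ a)
          = algebraMap A _ (ε a) * (s p.1 * shift t p.2)
            + algebraMap A _ (δ a) * (shift s p.1 * t p.2) := fun p _ => by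
      rw [PoissonStructure.mul_bracket, hs.bracket_eq_shift, ht.bracket_eq_shift]
      ring
    rw [map_sum, LinearMap.sum_apply, Finset.sum_congr rfl e3, Finset.sum_add_distrib,
      ← Finset.mul_sum, ← Finset.mul_sum, e1, e2, Derivation.add_apply, map_add]
    ring

/-- By Jacobi, bracketing `{s_m, t_n}` with `a` involves only `{s_m, t_{n-1}}`, `{s_{m-1}, t_n}` and
`(δ ε - ε δ)(a) s_{m-1} t_{n-1}`. By induction this is the bracket of the right side with `a`, since
`{u_1, a} = [δ, ε](a)`. -/
theorem bracket_bracket (hs : IsSymbolSeq δ ⊤ s) (ht : IsSymbolSeq ε ⊤ t)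
    (hu : IsSymbolSeq ⁅δ, ε⁆ ⊤ u) (N : ℕ) : ∀ m n, m + n = N →
      (grPoisson k A).bracket (s m) (t n) = shift s m * shift t n * u 1 := by
  induction N with
  | zero =>
    intro m n h
    obtain ⟨rfl, rfl⟩ : m = 0 ∧ n = 0 := by omega
    rw [hs.zero, PoissonStructure.bracket_one_left, shift_zero, zero_mul, zero_mul]
  | succ N ih =>
    rintro (_ | m) (_ | n) h
    · omega
    · rw [hs.zero, PoissonStructure.bracket_one_left, shift_zero, zero_mul, zero_mul]
    · rw [ht.zero, PoissonStructure.bracket_one_right, shift_zero, mul_zero, zero_mul]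
    · have hmem := bracket_mem_grPart (hs.mem (m + 1) le_top) (ht.mem (n + 1) le_top)
      rw [show m + 1 + (n + 1) - 1 = m + n + 1 by omega] at hmem
      refine eq_of_bracket_eq (n := m + n) hmem (SetLike.mul_mem_graded
        (SetLike.mul_mem_graded (hs.mem m le_top) (ht.mem n le_top)) (hu.mem 1 le_top))
        fun a => ?_
      have h1 := ih (m + 1) n (by omega)
      have h2 := ih m (n + 1) (by omega)
      have h3 := hu.bracket 0 le_top a
      rw [hu.zero, mul_one, Derivation.commutator_apply, map_sub, zero_add] at h3
      rw [shift_succ] at h1 h2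
      rw [shift_succ, shift_succ, PoissonStructure.bracket_bracket, hs.bracket _ le_top,
        ht.bracket _ le_top, PoissonStructure.bracket_mul, PoissonStructure.bracket_mul,
        hs.bracket _ le_top, ht.bracket _ le_top, h1,
        PoissonStructure.bracket_skew _ (t (n + 1)) (s m), h2,
        PoissonStructure.mul_bracket, PoissonStructure.mul_bracket, h3, hs.bracket_eq_shift,
        ht.bracket_eq_shift]
      ring

end IsSymbolSeq

end SymbolSequence

/-! ### The map `ϑ` -/

section Theta

variable {k A : Type*} [CommRing k] [CommRing A] [Algebra k A]

/-- The sequence of the symbols `σ_n(D_n)` for `n`-integrals `D` of `δ`. -/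
def symbolSeq (δ : Derivation k A A) (h : δ ∈ IDerF k A) : ℕ → GrDiffOp k A :=
  (exists_isSymbolSeq h).choose

theorem isSymbolSeq_symbolSeq {δ : Derivation k A A} (h : δ ∈ IDerF k A) :
    IsSymbolSeq δ ⊤ (symbolSeq δ h) := (exists_isSymbolSeq h).choose_spec

variable {L : LieRinehartSubalgebra A (Derivation k A A)}

/-- The defining relations of `Γ_A L` hold for symbol sequences. Only `L ≤ IDerF` matters, so both
choices of `L` are covered. -/
theorem exists_theta (hL : L.toSubmodule ≤ IDerF k A) :
    ∃ θ : DividedPowerAlgebra A L →ₐ[A] GrDiffOp k A,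
      (∀ n, ∀ x ∈ gammaPart A L n, θ x ∈ grPart k A n) ∧
      ∀ δ : L, IsSymbolSeq δ.1 ⊤ (fun n => θ (dp A n δ)) := by
  have hs := fun δ : L => isSymbolSeq_symbolSeq (hL δ.2)
  refine ⟨DividedPowerAlgebra.lift' (f := fun p : ℕ × L => symbolSeq p.2.1 (hL p.2.2) p.1)
    (fun δ => (hs δ).zero)
    (fun n r δ => (hs (r • δ)).unique ((hs δ).smul r) n le_top)
    (fun m n δ => (hs δ).mul _ m n rfl)
    (fun n δ ε => (hs (δ + ε)).unique ((hs δ).add (hs ε)) n le_top), ?_, fun δ => ?_⟩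
  · rintro n _ ⟨p, hp, rfl⟩
    rw [AlgHom.toLinearMap_apply, RingCon.mkₐ_apply, DividedPowerAlgebra.lift'_apply,
      MvPolynomial.aeval_def, MvPolynomial.eval₂_eq]
    refine sum_mem fun d hd => algebraMap_mul_mem_grPart _ ?_
    -- Each monomial occurring has weight `n`, and the generator `(i, δ)` of weight `i` goes to
    -- degree `i`.
    have hw := hp (MvPolynomial.mem_support_iff.1 hd)
    rw [Finsupp.weight_apply] at hw
    rw [← hw]
    exact SetLike.prod_mem_graded _ _ _ fun i _ =>
      SetLike.pow_mem_graded _ ((hs i.2).mem i.1 le_top)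
  · simp only [DividedPowerAlgebra.lift'_apply_dp]
    exact hs δ

/-- On generators, compatibility is the recursion defining a symbol sequence together with
`bracket_bracket`. -/
theorem isPoissonMap_theta {θ : DividedPowerAlgebra A L →ₐ[A] GrDiffOp k A}
    (hθ : ∀ δ : L, IsSymbolSeq δ.1 ⊤ (fun n => θ (dp A n δ)))
    {P : PoissonStructure k (DividedPowerAlgebra A L)} (hP : IsCanonicalPoisson L P) :
    IsPoissonMap P (grPoisson k A) θ := by
  refine isPoissonMap_of_generators P (grPoisson k A) θ.toRingHom (fun a b => ?_)
    (fun n δ a => ?_) (fun m n δ ε => ?_) <;>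
    simp only [AlgHom.toRingHom_eq_coe, RingHom.coe_coe, AlgHom.commutes]
  · rw [hP.base_base, map_zero, bracket_algebraMap_algebraMap]
  · cases n with
    | zero =>
      rw [DividedPowerAlgebra.dp_zero, map_one θ, PoissonStructure.bracket_one_left,
        PoissonStructure.bracket_one_left, map_zero]
    | succ n =>
      rw [hP.dp_base, Algebra.smul_def, map_mul, AlgHom.commutes]
      exact ((hθ δ).bracket n le_top a).symm
  · cases m with
    | zero =>
      rw [DividedPowerAlgebra.dp_zero, map_one θ, PoissonStructure.bracket_one_left,
        PoissonStructure.bracket_one_left, map_zero]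
    | succ m =>
      cases n with
      | zero =>
        rw [DividedPowerAlgebra.dp_zero, map_one θ, PoissonStructure.bracket_one_right,
          PoissonStructure.bracket_one_right, map_zero]
      | succ n =>
        rw [hP.dp_dp, map_mul, map_mul]
        exact ((hθ δ).bracket_bracket (hθ ε) (hθ ⁅δ, ε⁆) _ (m + 1) (n + 1) rfl).symm

theorem IsSymbolSeq.eq_symbol {δ : Derivation k A A} {s : ℕ → GrDiffOp k A}
    (hs : IsSymbolSeq δ ⊤ s) {m : ℕ∞} (D : HasseSchmidt k A m) (hD : D.coeff 1 = (δ : A →ₗ[k] A))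
    {n : ℕ} (hn : n ≤ m) : s n = symbol n ⟨D.coeff n, D.coeff_mem n⟩ :=
  (hs.mono le_top).unique (D.isSymbolSeq hD) n hn

theorem IsThetaF.eq (hL : L.toSubmodule ≤ IDerF k A)
    {θ θ' : DividedPowerAlgebra A L →ₐ[A] GrDiffOp k A} (h : IsThetaF L θ) (h' : IsThetaF L θ') :
    θ' = θ := by
  refine DividedPowerAlgebra.algHom_ext fun n δ => ?_
  rcases Nat.eq_zero_or_pos n with rfl | hn
  · rw [DividedPowerAlgebra.dp_zero, map_one, map_one]
  · have hδ := hL δ.2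
    simp only [IDerF, Submodule.mem_iInf] at hδ
    obtain ⟨D, hD⟩ := hδ n hn
    rw [h.apply_dp δ n hn D hD, h'.apply_dp δ n hn D hD]

theorem IsThetaInf.eq (hL : L.toSubmodule ≤ IDer k A ⊤)
    {θ θ' : DividedPowerAlgebra A L →ₐ[A] GrDiffOp k A} (h : IsThetaInf L θ)
    (h' : IsThetaInf L θ') : θ' = θ := by
  refine DividedPowerAlgebra.algHom_ext fun n δ => ?_
  rcases Nat.eq_zero_or_pos n with rfl | hn
  · rw [DividedPowerAlgebra.dp_zero, map_one, map_one]
  · obtain ⟨D, hD⟩ := hL δ.2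
    rw [h.apply_dp δ n hn D hD, h'.apply_dp δ n hn D hD]

end Theta

end PoissonHS

end

theorem mainTheorem8 {k A : Type*} [CommRing k] [CommRing A] [Algebra k A] :
    (∃ L : LieRinehartSubalgebra A (Derivation k A A),
      L.toSubmodule = PoissonHS.IDerF k A ∧
      ∃ (P : PoissonHS.PoissonStructure k (DividedPowerAlgebra A L))
        (θ : DividedPowerAlgebra A L →ₐ[A] PoissonHS.GrDiffOp k A),
        PoissonHS.IsCanonicalPoisson L P ∧
        (∀ P', PoissonHS.IsCanonicalPoisson L P' → P' = P) ∧
        PoissonHS.IsThetaF L θ ∧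
        (∀ θ', PoissonHS.IsThetaF L θ' → θ' = θ) ∧
        PoissonHS.IsPoissonMap P (PoissonHS.grPoisson k A) θ) ∧
    (∃ L : LieRinehartSubalgebra A (Derivation k A A),
      L.toSubmodule = PoissonHS.IDer k A ⊤ ∧
      ∃ (P : PoissonHS.PoissonStructure k (DividedPowerAlgebra A L))
        (θ : DividedPowerAlgebra A L →ₐ[A] PoissonHS.GrDiffOp k A),
        PoissonHS.IsCanonicalPoisson L P ∧
        (∀ P', PoissonHS.IsCanonicalPoisson L P' → P' = P) ∧
        PoissonHS.IsThetaInf L θ ∧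
        (∀ θ', PoissonHS.IsThetaInf L θ' → θ' = θ) ∧
        PoissonHS.IsPoissonMap P (PoissonHS.grPoisson k A) θ) := by
  constructor
  · let L : LieRinehartSubalgebra A (Derivation k A A) :=
      { PoissonHS.IDerF k A with lie_mem' := PoissonHS.lie_mem_IDerF }
    obtain ⟨θ, hgr, hθ⟩ := PoissonHS.exists_theta (L := L) le_rfl
    have hP := PoissonHS.isCanonicalPoisson_gammaPoisson L
    have hF : PoissonHS.IsThetaF L θ :=
      ⟨hgr, fun δ n _ D hD => (hθ δ).eq_symbol D hD le_rfl⟩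
    exact ⟨L, rfl, PoissonHS.gammaPoisson L, θ, hP, fun _ h => hP.eq h, hF,
      fun _ h => hF.eq le_rfl h, PoissonHS.isPoissonMap_theta hθ hP⟩
  · let L : LieRinehartSubalgebra A (Derivation k A A) :=
      { PoissonHS.IDer k A ⊤ with lie_mem' := PoissonHS.lie_mem_IDer }
    -- Existence comes from finite lengths; `∞`-integrals enter in identifying the values of `θ` and
    -- in its uniqueness.
    obtain ⟨θ, hgr, hθ⟩ := PoissonHS.exists_theta (L := L) PoissonHS.IDer_top_le_IDerF
    have hP := PoissonHS.isCanonicalPoisson_gammaPoisson L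
    have hI : PoissonHS.IsThetaInf L θ :=
      ⟨hgr, fun δ n _ D hD => (hθ δ).eq_symbol D hD le_top⟩
    exact ⟨L, rfl, PoissonHS.gammaPoisson L, θ, hP, fun _ h => hP.eq h, hI,
      fun _ h => hI.eq le_rfl h, PoissonHS.isPoissonMap_theta hθ hP⟩
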